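/- Let $M=\mathbb C/\Lambda$ be a one-dimensional complex torus, let $\lambda_1,\lambda_2$ be a basis of $\Lambda$ with $\operatorname{Im}(\lambda_2/\lambda_1)>0$, and let $L_0\to M$ be a positive holomorphic line bundle of degree $\delta\ge 1$, that is, $c_1(L_0)=[\delta\,dx_1\wedge dx_2]$, where $x_1,x_2$ are the real coordinates dual to $\lambda_1,\lambda_2$. Write $T_\mu:M\to M$ for the translation by $\mu$ and $L_\mu=T_\mu^*L_0$. Let $\hat M=\operatorname{Pic}^0(M)$ be the dual torus $H^{0,1}_{\bar\partial}(M)/H^1(M,\mathbb Z)$, that is, the quotient of $\{\sigma\,d\bar z:\sigma\in\mathbb C\}$ by the lattice of those $\sigma\,d\bar z$ with $2\operatorname{Re}(\sigma\bar\lambda)\in\mathbb Z$ for all $\lambda\in\Lambda$; the point $[\sigma]$ corresponds to the line bundle $\mathrm P_{[\sigma]}$ on $M$ with multipliers $e_\lambda=e^{2\pi i\sigma\bar\lambda}$. Let $\mathrm P\to M\times\hat M$ be the Poincaré line bundle, the holomorphic line bundle whose restriction to each $M\times\{[\sigma]\}$ is isomorphic to $\mathrm P_{[\sigma]}$ and whose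 restriction to $\{0\}\times\hat M$ is trivial. Then there is a holomorphic map $\varphi_{L_0}:M\to\hat M$ that sends each $\mu\in M$ to the unique point of $\hat M=\operatorname{Pic}^0(M)$ representing $T_\mu^*L_0\otimes L_0^*$. With $\pi_1,\pi_2$ the two projections (of $M\times\hat M$, respectively of $M\times M$), put $$\widetilde E=\pi_1^*L_0\otimes \mathrm P\to M\times\hat M,\qquad \widetilde{E'}=\pi_1^*L_0\otimes(\mathrm{Id}\times\varphi_{L_0})^*\mathrm P\to M\times M,$$ $$E=(\pi_2)_*\widetilde E\to\hat M,\qquad E'=(\pi_2)_*\widetilde{E'}\to M .$$ Then $E$ and $E'$ are holomorphic vector bundles of rank $\delta$, with fibres $H^0$ of the restrictions of $\widetilde E$ and $\widetilde{E'}$ to the slices $M\times\{\hat\mu\}$ and $M\times\{\mu\}$. Moreover $\widetilde{E'}|_{M\times\{\mu\}}\cong L_\mu$ for every $\mu\in M$, so that $E'|_\mu\cong H^0(M,L_\mu)$, and: 1. $\varphi_{L_0}^*E= E'$ on $M$: the natural map $\theta\mapsto\theta\circ(\mathrm{Id}\times\varphi_{L_0})$ is an isomorphism of holomorphic vector bundles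 $\varphi_{L_0}^*E\to E'$. 2. $E'$ splits holomorphically as a direct sum of $\delta$ holomorphic line bundles, each of which is isomorphic to the dual $L_0^*$ of $L_0$: $E'\cong (L_0^*)^{\oplus\delta}$. -/

import Mathlib

open scoped ComplexConjugate

noncomputable section

namespace TorusBundles

/-! ### Complex tori, holomorphic maps and holomorphic line bundles

A complex torus is a quotient `V ⧸ Λ` of a complex vector space by a lattice. Its complex structure
is the one for which `V → V ⧸ Λ` is locally biholomorphic, so a function on an open set `U` of
`V ⧸ Λ` is holomorphic if and only if its composition with `V → V ⧸ Λ` is holomorphic on the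
preimage of `U`. -/

section General

variable {V W : Type} [NormedAddCommGroup V] [NormedSpace ℂ V]
  [NormedAddCommGroup W] [NormedSpace ℂ W]

/-- The points of `V` over a given point of `V ⧸ Λ`. -/
abbrev Over (Λ : AddSubgroup V) (x : V ⧸ Λ) : Type := {v : V // (v : V ⧸ Λ) = x}

/-- The preimage in `V` of a subset of `V ⧸ Λ`. -/
def preim (Λ : AddSubgroup V) (U : Set (V ⧸ Λ)) : Set V := {v | (v : V ⧸ Λ) ∈ U}

/-- `c` is a holomorphic function on the (open) subset `U` of `V ⧸ Λ`; the values of `c` outside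
`U` are irrelevant. -/
def HolOn (Λ : AddSubgroup V) (U : Set (V ⧸ Λ)) (c : V ⧸ Λ → ℂ) : Prop :=
  DifferentiableOn ℂ (fun v : V => c (v : V ⧸ Λ)) (preim Λ U)

/-- A holomorphic map `V ⧸ Λ → W ⧸ Λ'`, presented by a holomorphic lift `V → W` to the universal
covers together with the homomorphism `Λ → Λ'` by which this lift is equivariant. -/
structure TorusMap (Λ : AddSubgroup V) (Λ' : AddSubgroup W) where
  lift : V → W
  holo : Differentiable ℂ lift
  per : Λ →+ Λ'
  equivariant : ∀ (l : Λ) (v : V), lift (v + l) = lift v + per l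

/-- The map of quotients that a `TorusMap` presents. -/
def TorusMap.map {Λ : AddSubgroup V} {Λ' : AddSubgroup W} (f : TorusMap Λ Λ') :
    V ⧸ Λ → W ⧸ Λ' :=
  Quotient.map' f.lift (by
    intro a b hab
    rw [QuotientAddGroup.leftRel_apply] at hab ⊢
    have h := f.equivariant ⟨-a + b, hab⟩ a
    simp only [add_neg_cancel_left] at h
    rw [h, neg_add_cancel_left]
    exact (f.per _).2)

/-- A holomorphic line bundle on `V ⧸ Λ`, given by a system of multipliers `e_l`, `l ∈ Λ`: it is
the quotient of `V × ℂ` by `l · (v, c) = (v + l, e_l(v) c)`. -/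
structure LineBundle (Λ : AddSubgroup V) where
  e : Λ → V → ℂ
  holo : ∀ l, Differentiable ℂ (e l)
  ne_zero : ∀ l v, e l v ≠ 0
  cocycle : ∀ l m v, e (l + m) v = e l (v + m) * e m v

namespace LineBundle

variable {Λ : AddSubgroup V} {Λ' : AddSubgroup W}

/-- Isomorphism of holomorphic line bundles: the multipliers differ by the coboundary of a
nowhere vanishing holomorphic function. -/
def IsIso (L L' : LineBundle Λ) : Prop :=
  ∃ h : V → ℂ, Differentiable ℂ h ∧ (∀ v, h v ≠ 0) ∧
    ∀ (l : Λ) (v : V), L'.e l v * h v = h (v + l) * L.e l v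

/-- The tensor product of two line bundles. -/
def tensor (L L' : LineBundle Λ) : LineBundle Λ where
  e l v := L.e l v * L'.e l v
  holo l := (L.holo l).mul (L'.holo l)
  ne_zero l v := mul_ne_zero (L.ne_zero l v) (L'.ne_zero l v)
  cocycle l m v := by rw [L.cocycle, L'.cocycle]; ring

/-- The dual of a line bundle. -/
def dual (L : LineBundle Λ) : LineBundle Λ where
  e l v := (L.e l v)⁻¹
  holo l := (L.holo l).inv (L.ne_zero l)
  ne_zero l v := inv_ne_zero (L.ne_zero l v)
  cocycle l m v := by rw [L.cocycle, mul_inv]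

/-- The pullback of a line bundle. -/
def pullback (L : LineBundle Λ') (f : TorusMap Λ Λ') : LineBundle Λ where
  e l v := L.e (f.per l) (f.lift v)
  holo l := (L.holo _).comp f.holo
  ne_zero l v := L.ne_zero _ _
  cocycle l m v := by rw [map_add, L.cocycle, f.equivariant]

end LineBundle

/-! ### The holomorphic maps that are used -/

/-- The translation by `μ`. -/
def translation (Λ : AddSubgroup V) (μ : V) : TorusMap Λ Λ where
  lift v := v + μ
  holo := by fun_prop
  per := AddMonoidHom.id Λ
  equivariant l v := by simp only [AddMonoidHom.id_apply]; abel

/-- The projection to the first factor. -/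
def proj₁ (Λ : AddSubgroup V) (Λ' : AddSubgroup W) : TorusMap (Λ.prod Λ') Λ where
  lift p := p.1
  holo := by fun_prop
  per :=
    { toFun := fun l => ⟨l.1.1, (AddSubgroup.mem_prod.1 l.2).1⟩
      map_zero' := rfl
      map_add' := fun _ _ => rfl }
  equivariant _ _ := rfl

/-- The inclusion of `V ⧸ Λ` as the slice over the point `[w]` of the second factor. -/
def slice (Λ : AddSubgroup V) (Λ' : AddSubgroup W) (w : W) : TorusMap Λ (Λ.prod Λ') where
  lift v := (v, w)
  holo := by fun_prop
  per :=
    { toFun := fun l => ⟨(l, 0), AddSubgroup.mem_prod.2 ⟨l.2, Λ'.zero_mem⟩⟩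
      map_zero' := rfl
      map_add' := fun _ _ => Subtype.ext (Prod.ext rfl (add_zero _).symm) }
  equivariant _ _ := Prod.ext rfl (add_zero _).symm

/-- The map `Id × f`. -/
def idProd {U : Type} [NormedAddCommGroup U] [NormedSpace ℂ U] (Λ₀ : AddSubgroup U)
    {Λ : AddSubgroup V} {Λ' : AddSubgroup W} (f : TorusMap Λ Λ') :
    TorusMap (Λ₀.prod Λ) (Λ₀.prod Λ') where
  lift p := (p.1, f.lift p.2)
  holo := differentiable_fst.prodMk (f.holo.comp differentiable_snd)
  per :=
    { toFun := fun l => ⟨(l.1.1, f.per ⟨l.1.2, (AddSubgroup.mem_prod.1 l.2).2⟩),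
        AddSubgroup.mem_prod.2 ⟨(AddSubgroup.mem_prod.1 l.2).1, (f.per _).2⟩⟩
      map_zero' := Subtype.ext (Prod.ext rfl (congrArg Subtype.val (map_zero f.per)))
      map_add' := fun l m => Subtype.ext (Prod.ext rfl (congrArg Subtype.val
        (map_add f.per ⟨l.1.2, (AddSubgroup.mem_prod.1 l.2).2⟩
          ⟨m.1.2, (AddSubgroup.mem_prod.1 m.2).2⟩))) }
  equivariant l v :=
    Prod.ext rfl (f.equivariant ⟨l.1.2, (AddSubgroup.mem_prod.1 l.2).2⟩ v.2)

/-! ### Holomorphic vector bundles -/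

/-- A family of complex vector spaces over `V ⧸ Λ`, together with a notion of holomorphic section
over an open set. A section is written as a total function, of which only the values on the open
set matter. -/
structure PreBundle (Λ : AddSubgroup V) where
  Fiber : V ⧸ Λ → Type
  [addCommGroup : ∀ x, AddCommGroup (Fiber x)]
  [module : ∀ x, Module ℂ (Fiber x)]
  IsHol : Set (V ⧸ Λ) → (∀ x, Fiber x) → Prop

attribute [instance] PreBundle.addCommGroup PreBundle.module

namespace PreBundle

variable {Λ : AddSubgroup V} {Λ' : AddSubgroup W}

/-- The family is a holomorphic vector bundle of rank `r`: being a holomorphic section is a local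
property, and near every point there is a frame of `r` sections, a basis of each fibre, such that
the holomorphic sections are exactly the combinations of the frame with holomorphic coefficients. -/
structure IsVectorBundle (E : PreBundle Λ) (r : ℕ) : Prop where
  isHol_iff_local : ∀ U : Set (V ⧸ Λ), IsOpen U → ∀ s : (∀ x, E.Fiber x),
    E.IsHol U s ↔ ∀ x ∈ U, ∃ U' ⊆ U, IsOpen U' ∧ x ∈ U' ∧ E.IsHol U' s
  exists_frame : ∀ x : V ⧸ Λ, ∃ U : Set (V ⧸ Λ), IsOpen U ∧ x ∈ U ∧
    ∃ b : Fin r → (∀ y, E.Fiber y),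
      (∀ y ∈ U, LinearIndependent ℂ (fun i => b i y) ∧
        Submodule.span ℂ (Set.range fun i => b i y) = ⊤) ∧
      ∀ U' ⊆ U, IsOpen U' → ∀ s : (∀ y, E.Fiber y),
        E.IsHol U' s ↔ ∃ c : Fin r → V ⧸ Λ → ℂ, (∀ i, HolOn Λ U' (c i)) ∧
          ∀ y ∈ U', s y = ∑ i, c i y • b i y

/-- A holomorphic isomorphism: fibrewise linear isomorphisms under which the holomorphic sections
over every open set correspond. -/
structure Iso (E F : PreBundle Λ) where
  equiv : ∀ x, E.Fiber x ≃ₗ[ℂ] F.Fiber x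
  isHol_iff : ∀ U : Set (V ⧸ Λ), IsOpen U → ∀ s : (∀ x, E.Fiber x),
    E.IsHol U s ↔ F.IsHol U (fun x => equiv x (s x))

/-- The pullback `f^* E`: its fibre at `x` is the fibre of `E` at `f x`, and its holomorphic
sections are locally the combinations, with holomorphic coefficients, of the pullbacks of
holomorphic sections of `E`. -/
def pullback (E : PreBundle Λ') (f : TorusMap Λ Λ') : PreBundle Λ where
  Fiber x := E.Fiber (f.map x)
  IsHol U s := ∀ x ∈ U, ∃ U' ⊆ U, IsOpen U' ∧ x ∈ U' ∧
    ∃ U'' : Set (W ⧸ Λ'), IsOpen U'' ∧ (∀ y ∈ U', f.map y ∈ U'') ∧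
    ∃ (n : ℕ) (t : Fin n → (∀ y, E.Fiber y)) (c : Fin n → V ⧸ Λ → ℂ),
      (∀ i, E.IsHol U'' (t i)) ∧ (∀ i, HolOn Λ U' (c i)) ∧
      ∀ y ∈ U', s y = ∑ i, c i y • t i (f.map y)

/-- The direct sum of a family of (pre)bundles. -/
def directSum {ι : Type} (E : ι → PreBundle Λ) : PreBundle Λ where
  Fiber x := ∀ i, (E i).Fiber x
  IsHol U s := ∀ i, (E i).IsHol U (fun x => s x i)

end PreBundle

namespace LineBundle

variable {Λ : AddSubgroup V} {Λ' : AddSubgroup W}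

/-- The fibre at `x` of the line bundle with multipliers `e_l`: the functions `θ` on the points
over `x` with `θ(v + l) = e_l(v) θ(v)`. -/
def fiber (L : LineBundle Λ) (x : V ⧸ Λ) : Submodule ℂ (Over Λ x → ℂ) where
  carrier := {θ | ∀ (l : Λ) (v v' : Over Λ x), v'.1 = v.1 + l → θ v' = L.e l v.1 * θ v}
  zero_mem' := by intro l v v' _; simp
  add_mem' := by
    intro a b ha hb l v v' h
    simp only [Pi.add_apply, ha l v v' h, hb l v v' h, mul_add]
  smul_mem' := by
    intro c a ha l v v' h
    simp only [Pi.smul_apply, smul_eq_mul, ha l v v' h]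
    ring

/-- A line bundle with its fibres and its holomorphic sections: a section is the same as a function
`θ` on the preimage in `V` with `θ(v + l) = e_l(v) θ(v)`, and is holomorphic when `θ` is. -/
def toPreBundle (L : LineBundle Λ) : PreBundle Λ where
  Fiber x := L.fiber x
  IsHol U s := DifferentiableOn ℂ (fun v : V => (s (v : V ⧸ Λ)).1 ⟨v, rfl⟩) (preim Λ U)

/-- For a line bundle on `V ⧸ Λ × W ⧸ Λ'` and a point `x` of `W ⧸ Λ'`, the space `H⁰` of the
restriction to the slice `V ⧸ Λ × {x}`: the functions `θ` on the preimage of the slice in `V × W`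
that are holomorphic along `V` and satisfy `θ(z + l, w + n) = e_(l,n)(z, w) θ(z, w)`. -/
def sliceSections (L : LineBundle (Λ.prod Λ')) (x : W ⧸ Λ') :
    Submodule ℂ (V → Over Λ' x → ℂ) where
  carrier := {θ | (∀ w, Differentiable ℂ (fun z => θ z w)) ∧
    ∀ (l : Λ.prod Λ') (z : V) (w w' : Over Λ' x), w'.1 = w.1 + l.1.2 →
      θ (z + l.1.1) w' = L.e l (z, w.1) * θ z w}
  zero_mem' := by
    refine ⟨fun w => ?_, fun l z w w' _ => ?_⟩
    · simp
    · simp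
  add_mem' := by
    intro a b ha hb
    refine ⟨fun w => (ha.1 w).add (hb.1 w), fun l z w w' h => ?_⟩
    simp only [Pi.add_apply, ha.2 l z w w' h, hb.2 l z w w' h, mul_add]
  smul_mem' := by
    intro c a ha
    refine ⟨fun w => (ha.1 w).const_smul c, fun l z w w' h => ?_⟩
    simp only [Pi.smul_apply, smul_eq_mul, ha.2 l z w w' h]
    ring

/-- The direct image under the second projection `V ⧸ Λ × W ⧸ Λ' → W ⧸ Λ'` of a line bundle: the
fibre at `x` is `H⁰` of the restriction to the slice over `x`, and the holomorphic sections over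
`U` are the holomorphic sections of the line bundle over `V ⧸ Λ × U`. -/
def directImage (L : LineBundle (Λ.prod Λ')) : PreBundle Λ' where
  Fiber x := L.sliceSections x
  IsHol U s := DifferentiableOn ℂ
    (fun p : V × W => (s (p.2 : W ⧸ Λ')).1 p.1 ⟨p.2, rfl⟩) (Set.univ ×ˢ preim Λ' U)

end LineBundle

end General

/-! ### One-dimensional tori, the dual torus and the Poincaré line bundle -/

/-- The lattice `ℤ l₁ + ℤ l₂`. -/
def lattice (l₁ l₂ : ℂ) : AddSubgroup ℂ := AddSubgroup.closure {l₁, l₂}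

/-- For an oriented basis `l₁, l₂` of the lattice and `x₁, x₂` the dual real coordinates, `c₁(L)` is
the class of `d • dx₁ ∧ dx₂`, that is, `L` has degree `d`. The class `c₁` is computed by the
connecting homomorphism of the exponential sequence: if `exp(2πi f₁)` and `exp(2πi f₂)` are the
multipliers of `l₁` and `l₂`, then `d` is the constant
`(f₁(z + l₂) - f₁(z)) - (f₂(z + l₁) - f₂(z))`, which is also the number of zeros of a section in a
period parallelogram. -/
def HasDegree {l₁ l₂ : ℂ} (L : LineBundle (lattice l₁ l₂)) (d : ℤ) : Prop :=
  ∃ f₁ f₂ : ℂ → ℂ, Differentiable ℂ f₁ ∧ Differentiable ℂ f₂ ∧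
    (∀ z, L.e ⟨l₁, AddSubgroup.subset_closure (Set.mem_insert _ _)⟩ z =
      Complex.exp (2 * Real.pi * Complex.I * f₁ z)) ∧
    (∀ z, L.e ⟨l₂, AddSubgroup.subset_closure (Set.mem_insert_of_mem _ rfl)⟩ z =
      Complex.exp (2 * Real.pi * Complex.I * f₂ z)) ∧
    ∀ z, (f₁ (z + l₂) - f₁ z) - (f₂ (z + l₁) - f₂ z) = d

/-- The image of `H¹(M, ℤ)` in the space `H^{0,1}(M) = {σ dz̄} ≅ ℂ` of conjugate linear functionals
on `ℂ`: those whose real part is half-integral on `Λ`. -/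
def dualLattice (Λ : AddSubgroup ℂ) : AddSubgroup ℂ where
  carrier := {σ | ∀ l ∈ Λ, ∃ n : ℤ, σ * conj l + conj σ * l = n}
  zero_mem' := fun l _ => ⟨0, by simp⟩
  add_mem' := by
    intro a b ha hb l hl
    obtain ⟨m, hm⟩ := ha l hl
    obtain ⟨n, hn⟩ := hb l hl
    refine ⟨m + n, ?_⟩
    push_cast
    rw [← hm, ← hn, map_add]
    ring
  neg_mem' := by
    intro a ha l hl
    obtain ⟨m, hm⟩ := ha l hl
    refine ⟨-m, ?_⟩
    push_cast
    rw [← hm, map_neg]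
    ring

/-- The Poincaré line bundle on `M × M̂`, where `M = ℂ ⧸ Λ` and `M̂ = Pic⁰(M)` is the dual torus
`ℂ ⧸ dualLattice Λ`. On the slice `M × {[σ]}` it is the line bundle with constant multipliers
`exp(2πi σ l̄)` that corresponds to the class of `σ dz̄`, and on `{0} × M̂` all its multipliers
are `1`. -/
def poincare (Λ : AddSubgroup ℂ) : LineBundle (Λ.prod (dualLattice Λ)) where
  e l p := Complex.exp (2 * Real.pi * Complex.I *
    ((p.2 + l.1.2) * conj l.1.1 - conj l.1.2 * p.1))
  holo l := by fun_prop
  ne_zero l p := Complex.exp_ne_zero _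
  cocycle l m p := by
    obtain ⟨n, hn⟩ := (AddSubgroup.mem_prod.1 l.2).2 m.1.1 (AddSubgroup.mem_prod.1 m.2).1
    rw [← Complex.exp_add, Complex.exp_eq_exp_iff_exists_int]
    refine ⟨n, ?_⟩
    rw [← hn]
    simp only [AddSubgroup.coe_add, Prod.fst_add, Prod.snd_add, map_add]
    ring

variable {Λ : AddSubgroup ℂ}

/-- `L_μ = T_μ^* L₀`. -/
def translate (L₀ : LineBundle Λ) (μ : ℂ) : LineBundle Λ := L₀.pullback (translation Λ μ)

/-- `φ : M → M̂` is the map `φ_{L₀}`: for every `μ`, the point `φ([μ])` is the only point `[σ]` of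
`M̂ = Pic⁰(M)` such that `P` restricted to `M × {[σ]}` is isomorphic to `T_μ^* L₀ ⊗ L₀^*`. -/
def IsPhi (L₀ : LineBundle Λ) (φ : TorusMap Λ (dualLattice Λ)) : Prop :=
  ∀ μ σ : ℂ,
    ((poincare Λ).pullback (slice Λ (dualLattice Λ) σ)).IsIso ((translate L₀ μ).tensor L₀.dual) ↔
      (σ : ℂ ⧸ dualLattice Λ) = φ.map (μ : ℂ ⧸ Λ)

/-- `Ẽ = π₁^* L₀ ⊗ P` on `M × M̂`. -/
def tildeE (L₀ : LineBundle Λ) : LineBundle (Λ.prod (dualLattice Λ)) :=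
  (L₀.pullback (proj₁ Λ (dualLattice Λ))).tensor (poincare Λ)

/-- `Ẽ' = π₁^* L₀ ⊗ (Id × φ)^* P` on `M × M`. -/
def tildeE' (L₀ : LineBundle Λ) (φ : TorusMap Λ (dualLattice Λ)) : LineBundle (Λ.prod Λ) :=
  (L₀.pullback (proj₁ Λ Λ)).tensor ((poincare Λ).pullback (idProd Λ φ))

/-- `E = (π₂)_* Ẽ` on `M̂`. -/
def bundleE (L₀ : LineBundle Λ) : PreBundle (dualLattice Λ) := (tildeE L₀).directImage

/-- `E' = (π₂)_* Ẽ'` on `M`. -/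
def bundleE' (L₀ : LineBundle Λ) (φ : TorusMap Λ (dualLattice Λ)) : PreBundle Λ :=
  (tildeE' L₀ φ).directImage

/-- An isomorphism `φ^* E ≅ E'` is the canonical one if, for `θ` in the fibre of `E` at `φ(x)`,
that is, for a section `θ` of `Ẽ` over `M × {φ(x)}`, it sends `θ` to the section
`(z, w) ↦ θ(z, φ(w))` of `Ẽ' = (Id × φ)^* Ẽ` over `M × {x}`. -/
def IsCanonical (L₀ : LineBundle Λ) (φ : TorusMap Λ (dualLattice Λ))
    (Φ : ((bundleE L₀).pullback φ).Iso (bundleE' L₀ φ)) : Prop :=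
  ∀ (x : ℂ ⧸ Λ) (θ : (tildeE L₀).sliceSections (φ.map x)) (z : ℂ) (w : Over Λ x)
    (w' : Over (dualLattice Λ) (φ.map x)), w'.1 = φ.lift w.1 →
      (show (tildeE' L₀ φ).sliceSections x from Φ.equiv x θ).1 z w = θ.1 z w'

end TorusBundles

end

/-! Put `a = δ / (conj l₁ * l₂ - l₁ * conj l₂)`, a purely imaginary number. The whole proof rests on
a normal form: up to the coboundary of a nowhere vanishing entire function `h`, the multipliers of
`L₀` are `C(l) exp(2πi a z l̄)` with constants `C(l)`. Indeed, if the logarithms of the multipliers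
are diminished by `a z l̄`, the degree cancels and an additive cocycle of entire functions remains.
It is cohomologous to a constant one, because the difference equation for one period is solvable for
every entire function, and the one for the other period, among functions with the first period, is
solvable up to the mean by Fourier series (`exists_primitive_of_cocycle`, `nonempty_normalForm`).

In normal form, translation by `μ` multiplies the multipliers by `exp(2πi a μ l̄)`, so `φ` is
induced by `w ↦ a w`; any lift of it is `a w + b` with `b` in the dual lattice (`isIso_iff`,
`exists_lift_eq`). Moreover, twisting by `P_σ` amounts to translating theta functions by `σ / a`.
Hence a single basis `ψ_i` of theta functions gives the global frame `h(z) ψ_i(z + σ / a)` of the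
direct image over the universal cover of the dual torus (`exists_relFrame`). The basis is chosen
dual to evaluation at points, so that coordinates are values of sections and vary holomorphically.
Local triviality and base change follow formally.

Over `M` the frame is `h(z) ψ_i(z + w + b / a)`, where `z` and `w` play symmetric roles. After
multiplication by `h(w) exp(2πi b̄ w)` each frame element acquires in `w` the multipliers of `L₀`,
apart from those of the bundle itself. The coordinates of a section therefore transform by the
multipliers of the dual of `L₀`, which is the asserted splitting (`nonempty_iso_directSum_dual`). -/

noncomputable section

/-! ### The difference equation `k (z + 1) - k z = f z` for entire functions. -/

open Complex Real intervalIntegral Set Filter Topology in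
theorem differentiable_intervalIntegral_exp_mul {u v : ℝ → ℂ} (hu : Continuous u)
    (hv : Continuous v) (a b : ℝ) :
    Differentiable ℂ fun z : ℂ => ∫ t in a..b, Complex.exp (z * u t) * v t := by
  intro z₀
  refine (intervalIntegral.hasDerivAt_integral_of_dominated_loc_of_deriv_le
    (F' := fun z t => Complex.exp (z * u t) * u t * v t)
    (bound := fun t => Real.exp ((‖z₀‖ + 1) * ‖u t‖) * ‖u t‖ * ‖v t‖)
    (Metric.ball_mem_nhds z₀ one_pos) ?_ ?_ ?_ ?_ ?_ ?_).2.differentiableAt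
  · exact Eventually.of_forall fun z => (by fun_prop : Continuous fun t =>
      Complex.exp (z * u t) * v t).aestronglyMeasurable
  · exact (by fun_prop : Continuous fun t => Complex.exp (z₀ * u t) * v t).intervalIntegrable _ _
  · exact (by fun_prop : Continuous fun t =>
      Complex.exp (z₀ * u t) * u t * v t).aestronglyMeasurable
  · refine Eventually.of_forall fun t _ z hz => ?_
    rw [norm_mul, norm_mul, Complex.norm_exp]
    gcongr
    have h1 : ‖z‖ ≤ ‖z₀‖ + 1 := by
      have := norm_sub_norm_le z z₀
      rw [Metric.mem_ball, dist_eq_norm] at hz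
      linarith
    calc (z * u t).re ≤ ‖z * u t‖ := Complex.re_le_norm _
      _ = ‖z‖ * ‖u t‖ := norm_mul _ _
      _ ≤ _ := by gcongr
  · exact Continuous.intervalIntegrable (by fun_prop) _ _
  · refine Eventually.of_forall fun t _ z _ => ?_
    have := (((hasDerivAt_id z).mul_const (u t)).cexp).mul_const (v t)
    simpa using this

/-- On the circles of radius `(2n+1)π` the function `exp ζ - 1` is bounded away from zero. -/
theorem half_le_norm_exp_sub_one (n : ℕ) (ζ : ℂ) (hζ : ‖ζ‖ = (2 * n + 1) * Real.pi) :
    1 / 2 ≤ ‖Complex.exp ζ - 1‖ := by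
  have hpi := Real.pi_gt_three
  have hre : (Complex.exp ζ).re = Real.exp ζ.re * Real.cos ζ.im := Complex.exp_re ζ
  rcases le_or_gt 1 |ζ.re| with h | h
  · have h1 : |‖Complex.exp ζ‖ - ‖(1 : ℂ)‖| ≤ ‖Complex.exp ζ - 1‖ := abs_norm_sub_norm_le _ _
    rw [Complex.norm_exp, norm_one] at h1
    refine le_trans ?_ h1
    rcases le_abs.1 h with h | h
    · have := Real.add_one_le_exp ζ.re
      exact le_trans (by linarith) (le_abs_self _)
    · have h2 : Real.exp ζ.re ≤ Real.exp (-1) := Real.exp_le_exp.2 (by linarith)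
      have h3 : Real.exp (-1) ≤ 1 / 2 := by
        rw [Real.exp_neg, one_div]
        exact inv_anti₀ two_pos (by linarith [Real.add_one_le_exp 1])
      exact le_trans (by linarith) (neg_le_abs _)
  -- When `|Re ζ| < 1`, `|Im ζ|` lies within `1` of the odd multiple `(2n+1)π`, so `cos (Im ζ) ≤ 0`
  -- and `exp ζ - 1` has real part at most `-1`.
  · have hsq : ζ.re ^ 2 + ζ.im ^ 2 = ((2 * n + 1) * Real.pi) ^ 2 := by
      rw [← hζ, Complex.sq_norm, Complex.normSq_apply]; ring
    have hR : Real.pi ≤ (2 * n + 1) * Real.pi := by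
      nlinarith [(Nat.cast_nonneg n : (0 : ℝ) ≤ n)]
    have hx : ζ.re ^ 2 < 1 := by
      rw [← sq_abs]; nlinarith [abs_nonneg ζ.re]
    have hy : |ζ.im| ≤ (2 * n + 1) * Real.pi := by
      refine abs_le_of_sq_le_sq ?_ (by linarith)
      nlinarith [sq_nonneg ζ.re]
    have hy' : (2 * n + 1) * Real.pi - 1 ≤ |ζ.im| := by
      by_contra hc
      push Not at hc
      have := sq_abs ζ.im
      nlinarith [abs_nonneg ζ.im]
    have hcos : Real.cos ζ.im = -Real.cos ((2 * n + 1) * Real.pi - |ζ.im|) := by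
      rw [← Real.cos_abs ζ.im,
        show (2 * n + 1) * Real.pi - |ζ.im| = (Real.pi - |ζ.im|) + n * (2 * Real.pi) by ring,
        Real.cos_add_nat_mul_two_pi, Real.cos_pi_sub, neg_neg]
    have hpos : 0 ≤ Real.cos ((2 * n + 1) * Real.pi - |ζ.im|) :=
      Real.cos_nonneg_of_mem_Icc ⟨by linarith, by linarith⟩
    have h2 : (Complex.exp ζ).re ≤ 0 := by
      rw [hre, hcos]; nlinarith [Real.exp_pos ζ.re]
    have h3 := Complex.abs_re_le_norm (Complex.exp ζ - 1)
    rw [Complex.sub_re, Complex.one_re] at h3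
    exact le_trans (by linarith [neg_le_abs ((Complex.exp ζ).re - 1)]) h3

/-- A solution of the difference equation with right-hand side `z ^ n / n!`. -/
def hurwitzSolution (n : ℕ) (z : ℂ) : ℂ :=
  (2 * Real.pi * Complex.I)⁻¹ * ∮ ζ in C(0, (2 * n + 1) * Real.pi),
    Complex.exp (z * ζ) * ((Complex.exp ζ - 1) * ζ ^ (n + 1))⁻¹

theorem hurwitz_denominator_ne_zero {n : ℕ} {ζ : ℂ}
    (hζ : ζ ∈ Metric.sphere (0 : ℂ) ((2 * n + 1) * Real.pi)) :
    (Complex.exp ζ - 1) * ζ ^ (n + 1) ≠ 0 := by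
  have h : ‖ζ‖ = (2 * n + 1) * Real.pi := by simpa using hζ
  refine mul_ne_zero (fun h0 => ?_) (pow_ne_zero _ fun h0 => ?_)
  · have := half_le_norm_exp_sub_one n ζ h
    rw [h0, norm_zero] at this
    norm_num at this
  · rw [h0, norm_zero] at h
    have : 0 < (2 * (n : ℝ) + 1) * Real.pi := by positivity
    linarith

theorem hurwitz_radius_pos (n : ℕ) : 0 < (2 * (n : ℝ) + 1) * Real.pi := by positivity

theorem differentiable_hurwitzSolution (n : ℕ) : Differentiable ℂ (hurwitzSolution n) := by
  refine Differentiable.const_mul ?_ _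
  have hc : Continuous fun t : ℝ => circleMap 0 ((2 * n + 1) * Real.pi) t := by fun_prop
  have h := differentiable_intervalIntegral_exp_mul hc
    (v := fun t => deriv (circleMap 0 ((2 * n + 1) * Real.pi)) t *
      ((Complex.exp (circleMap 0 ((2 * n + 1) * Real.pi) t) - 1) *
        circleMap 0 ((2 * n + 1) * Real.pi) t ^ (n + 1))⁻¹) (by
      simp only [deriv_circleMap]
      refine Continuous.mul (by fun_prop) (Continuous.inv₀ (by fun_prop) fun t => ?_)
      exact hurwitz_denominator_ne_zero (circleMap_mem_sphere _ (hurwitz_radius_pos n).le t))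
    0 (2 * Real.pi)
  refine Eq.mpr (congrArg (Differentiable ℂ) (funext fun z => ?_)) h
  unfold circleIntegral
  refine intervalIntegral.integral_congr fun t _ => ?_
  simp only [smul_eq_mul]
  ring

theorem circleIntegrable_hurwitz (n : ℕ) (z : ℂ) :
    CircleIntegrable (fun ζ => Complex.exp (z * ζ) * ((Complex.exp ζ - 1) * ζ ^ (n + 1))⁻¹) 0
      ((2 * n + 1) * Real.pi) := by
  refine ContinuousOn.circleIntegrable (hurwitz_radius_pos n).le ?_
  exact ContinuousOn.mul (by fun_prop) (ContinuousOn.inv₀ (by fun_prop)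
    fun ζ hζ => hurwitz_denominator_ne_zero hζ)

/-- Taking the difference cancels the denominator `exp ζ - 1`, and Cauchy's formula for the `n`-th
derivative of `ζ ↦ exp (z ζ)` at `0` remains. -/
theorem hurwitzSolution_add_one_sub (n : ℕ) (z : ℂ) :
    hurwitzSolution n (z + 1) - hurwitzSolution n z = z ^ n / n.factorial := by
  have hR := hurwitz_radius_pos n
  have hd : DiffContOnCl ℂ (fun ζ => Complex.exp (z * ζ))
      (Metric.ball 0 ((2 * n + 1) * Real.pi)) :=
    Differentiable.diffContOnCl (by fun_prop)
  have h := hd.circleIntegral_one_div_sub_center_pow_smul hR n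
  rw [hurwitzSolution, hurwitzSolution, ← mul_sub, ← circleIntegral.integral_sub
    (circleIntegrable_hurwitz n _) (circleIntegrable_hurwitz n _)]
  have h2 : (∮ ζ in C(0, (2 * n + 1) * Real.pi),
      (Complex.exp ((z + 1) * ζ) * ((Complex.exp ζ - 1) * ζ ^ (n + 1))⁻¹ -
        Complex.exp (z * ζ) * ((Complex.exp ζ - 1) * ζ ^ (n + 1))⁻¹)) =
      ∮ ζ in C(0, (2 * n + 1) * Real.pi), (1 / (ζ - 0) ^ (n + 1)) • Complex.exp (z * ζ) := by
    refine circleIntegral.integral_congr hR.le fun ζ hζ => ?_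
    have h0 := hurwitz_denominator_ne_zero hζ
    have h1 := left_ne_zero_of_mul h0
    have h3 := right_ne_zero_of_mul h0
    simp only [sub_zero, smul_eq_mul]
    rw [add_mul, one_mul, Complex.exp_add]
    field_simp
  rw [h2, h, iteratedDeriv_cexp_const_mul]
  simp only [mul_zero, Complex.exp_zero, mul_one, smul_eq_mul]
  rw [inv_mul_eq_iff_eq_mul₀ Complex.two_pi_I_ne_zero]
  ring

/-- The radius of the contour grows linearly in `n`: the denominator then outweighs `n!`, while the
exponential is only geometric in `n`. -/
theorem norm_hurwitzSolution_le (n : ℕ) (z : ℂ) :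
    ‖hurwitzSolution n z‖ ≤
      2 * Real.exp (‖z‖ * ((2 * n + 1) * Real.pi)) / ((2 * n + 1) * Real.pi) ^ n := by
  have hR := hurwitz_radius_pos n
  set R := (2 * (n : ℝ) + 1) * Real.pi with hRdef
  have h := circleIntegral.norm_two_pi_i_inv_smul_integral_le_of_norm_le_const (c := 0)
    (f := fun ζ => Complex.exp (z * ζ) * ((Complex.exp ζ - 1) * ζ ^ (n + 1))⁻¹)
    (C := Real.exp (‖z‖ * R) * (2 * (R ^ (n + 1))⁻¹)) hR.le (fun ζ hζ => by
      have hn : ‖ζ‖ = R := by simpa using hζ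
      rw [norm_mul, norm_inv, norm_mul, norm_pow, hn, mul_inv, Complex.norm_exp]
      gcongr
      · exact (Complex.re_le_norm _).trans (by rw [norm_mul, hn])
      · have := half_le_norm_exp_sub_one n ζ hn
        calc ‖Complex.exp ζ - 1‖⁻¹ ≤ (1 / 2)⁻¹ := inv_anti₀ (by norm_num) this
          _ = 2 := by norm_num)
  refine (le_of_eq ?_).trans (h.trans (le_of_eq ?_))
  · rw [hurwitzSolution, smul_eq_mul]
  · rw [pow_succ]
    field_simp

/-- Every entire function is a difference `k (z + 1) - k z` with `k` entire. -/
theorem exists_entire_add_one_sub_eq {f : ℂ → ℂ} (hf : Differentiable ℂ f) :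
    ∃ k : ℂ → ℂ, Differentiable ℂ k ∧ ∀ z, k (z + 1) - k z = f z := by
  -- `F n` solves the equation for the `n`-th Taylor term of `f`; what has to be shown is that the
  -- sum converges locally uniformly.
  set F : ℕ → ℂ → ℂ := fun n z => iteratedDeriv n f 0 * hurwitzSolution n z with hF
  have hbound : ∀ B : ℝ, 0 ≤ B → ∃ u : ℕ → ℝ, Summable u ∧
      ∀ n z, z ∈ Metric.ball (0 : ℂ) B → ‖F n z‖ ≤ u n := by
    intro B hB
    -- Cauchy's estimate on this radius gives `ρ ^ (-n)`, which turns the growth `exp (2πB) ^ n` of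
    -- the solutions into `(1/2) ^ n`.
    set ρ : ℝ := 2 * Real.exp (2 * Real.pi * B) with hρ
    have hρ0 : 0 < ρ := by positivity
    obtain ⟨M, hM⟩ := (isCompact_sphere (0 : ℂ) ρ).exists_bound_of_continuousOn
      hf.continuous.continuousOn
    refine ⟨fun n => 2 * |M| * Real.exp (B * Real.pi) * (1 / 2) ^ n,
      (summable_geometric_of_lt_one (by norm_num) (by norm_num)).mul_left _, fun n z hz => ?_⟩
    have hz' : ‖z‖ ≤ B := by simpa using (Metric.mem_ball.1 hz).le
    have h1 := Complex.norm_iteratedDeriv_le_of_forall_mem_sphere_norm_le n hρ0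
      (hf.diffContOnCl (s := Metric.ball 0 ρ)) (fun z hz => (hM z hz).trans (le_abs_self M))
    have h2 := norm_hurwitzSolution_le n z
    have hR := hurwitz_radius_pos n
    have hfac : (n.factorial : ℝ) ≤ ((2 * n + 1) * Real.pi) ^ n := by
      have : (n.factorial : ℝ) ≤ (n : ℝ) ^ n := by exact_mod_cast Nat.factorial_le_pow n
      refine this.trans (pow_le_pow_left₀ (Nat.cast_nonneg n) ?_ n)
      nlinarith [Real.pi_gt_three, (Nat.cast_nonneg n : (0 : ℝ) ≤ n)]
    have hexp : Real.exp (‖z‖ * ((2 * n + 1) * Real.pi)) ≤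
        Real.exp (B * Real.pi) * Real.exp (2 * Real.pi * B) ^ n := by
      rw [← Real.exp_nat_mul, ← Real.exp_add]
      apply Real.exp_le_exp.2
      calc ‖z‖ * ((2 * n + 1) * Real.pi) ≤ B * ((2 * n + 1) * Real.pi) := by gcongr
        _ = _ := by ring
    rw [hF]
    simp only [norm_mul]
    calc ‖iteratedDeriv n f 0‖ * ‖hurwitzSolution n z‖
        ≤ (n.factorial * |M| / ρ ^ n) *
          (2 * (Real.exp (B * Real.pi) * Real.exp (2 * Real.pi * B) ^ n) /
            ((2 * n + 1) * Real.pi) ^ n) := by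
          gcongr
          exact h2.trans (by gcongr)
      _ ≤ (((2 * n + 1) * Real.pi) ^ n * |M| / ρ ^ n) *
          (2 * (Real.exp (B * Real.pi) * Real.exp (2 * Real.pi * B) ^ n) /
            ((2 * n + 1) * Real.pi) ^ n) := by gcongr
      _ = 2 * |M| * Real.exp (B * Real.pi) * (1 / 2) ^ n := by
          rw [hρ, mul_pow, div_pow, one_pow]
          have := Real.exp_pos (2 * Real.pi * B)
          have h3 : (2 * (n : ℝ) + 1) * Real.pi ≠ 0 := hR.ne'
          generalize (2 * (n : ℝ) + 1) * Real.pi = R at *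
          field_simp
          rw [mul_pow]
          ring
  have hsum : ∀ z, Summable fun n => F n z := by
    intro z
    obtain ⟨u, hu, h⟩ := hbound (‖z‖ + 1) (by positivity)
    exact hu.of_norm_bounded fun n => h n z (by simp)
  refine ⟨fun z => ∑' n, F n z, fun z => ?_, fun z => ?_⟩
  · obtain ⟨u, hu, h⟩ := hbound (‖z‖ + 1) (by positivity)
    refine (Complex.differentiableOn_tsum_of_summable_norm hu (fun n => ?_) Metric.isOpen_ball
      fun n w hw => h n w hw).differentiableAt (Metric.isOpen_ball.mem_nhds (by simp))
    exact ((differentiable_hurwitzSolution n).const_mul _).differentiableOn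
  · refine ((hsum (z + 1)).hasSum.sub (hsum z).hasSum).unique ?_
    convert Complex.hasSum_taylorSeries_of_entire hf 0 z using 2 with n
    rw [hF]
    simp only
    rw [← mul_sub, hurwitzSolution_add_one_sub, smul_eq_mul, smul_eq_mul, sub_zero]
    ring

/-! ### Fourier series of entire functions of period `1`. -/

/-- The function `z ↦ exp (2πi z)`. -/
def expTwoPiI (z : ℂ) : ℂ := Complex.exp (2 * Real.pi * Complex.I * z)

theorem expTwoPiI_add (z w : ℂ) : expTwoPiI (z + w) = expTwoPiI z * expTwoPiI w := by
  rw [expTwoPiI, mul_add, Complex.exp_add]; rfl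

theorem expTwoPiI_ne_zero (z : ℂ) : expTwoPiI z ≠ 0 := Complex.exp_ne_zero _

theorem expTwoPiI_zero : expTwoPiI 0 = 1 := by simp [expTwoPiI]

theorem expTwoPiI_neg (z : ℂ) : expTwoPiI (-z) = (expTwoPiI z)⁻¹ := by
  rw [expTwoPiI, mul_neg, Complex.exp_neg]; rfl

theorem expTwoPiI_sub (z w : ℂ) : expTwoPiI (z - w) = expTwoPiI z / expTwoPiI w := by
  rw [sub_eq_add_neg, expTwoPiI_add, expTwoPiI_neg, div_eq_mul_inv]

theorem expTwoPiI_eq_one_iff {z : ℂ} : expTwoPiI z = 1 ↔ ∃ n : ℤ, z = n := by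
  rw [expTwoPiI, Complex.exp_eq_one_iff]
  refine exists_congr fun n => ?_
  rw [mul_comm (n : ℂ), mul_right_inj' Complex.two_pi_I_ne_zero]

theorem expTwoPiI_int (n : ℤ) : expTwoPiI n = 1 := expTwoPiI_eq_one_iff.2 ⟨n, rfl⟩

theorem exists_expTwoPiI_eq {c : ℂ} (hc : c ≠ 0) : ∃ z, expTwoPiI z = c := by
  refine ⟨Complex.log c / (2 * Real.pi * Complex.I), ?_⟩
  rw [expTwoPiI, mul_div_cancel₀ _ Complex.two_pi_I_ne_zero, Complex.exp_log hc]

@[fun_prop]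
theorem differentiable_expTwoPiI : Differentiable ℂ expTwoPiI := by
  unfold expTwoPiI; fun_prop

@[fun_prop]
theorem continuous_expTwoPiI : Continuous expTwoPiI := differentiable_expTwoPiI.continuous

theorem norm_expTwoPiI (z : ℂ) : ‖expTwoPiI z‖ = Real.exp (-(2 * Real.pi * z.im)) := by
  rw [expTwoPiI, Complex.norm_exp]; simp

/-- The integral over a period of an entire function does not change under translations. -/
theorem intervalIntegral_add_eq_of_periodic {F : ℂ → ℂ} (hF : Differentiable ℂ F)
    (hper : ∀ z, F (z + 1) = F z) (w : ℂ) :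
    ∫ x in (0 : ℝ)..1, F (x + w) = ∫ x in (0 : ℝ)..1, F x := by
  -- With a primitive `Φ` on a ball containing all segments involved, the integral is `Φ (1 + w) - Φ
  -- w`, whose derivative `F (1 + w) - F w` vanishes.
  obtain ⟨Φ, hΦ⟩ := (hF.differentiableOn (s := Metric.ball 0 (‖w‖ + 3))).isExactOn_ball
  have hmem : ∀ w' ∈ Metric.ball (0 : ℂ) (‖w‖ + 1), ∀ x ∈ Set.uIcc (0 : ℝ) 1,
      (x : ℂ) + w' ∈ Metric.ball (0 : ℂ) (‖w‖ + 3) := by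
    intro w' hw' x hx
    rw [Set.uIcc_of_le zero_le_one] at hx
    rw [mem_ball_zero_iff] at hw' ⊢
    have h1 : ‖(x : ℂ)‖ ≤ 1 := by
      rw [Complex.norm_real, Real.norm_eq_abs, abs_of_nonneg hx.1]; exact hx.2
    linarith [norm_add_le (x : ℂ) w']
  have hJ : ∀ w' ∈ Metric.ball (0 : ℂ) (‖w‖ + 1),
      ∫ x in (0 : ℝ)..1, F (x + w') = Φ (1 + w') - Φ w' := by
    intro w' hw'
    rw [intervalIntegral.integral_eq_sub_of_hasDerivAt (f := fun x : ℝ => Φ (x + w'))]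
    · simp
    · intro x hx
      have h1 := (hΦ _ (hmem w' hw' x hx)).comp_add_const (x : ℂ) w'
      exact h1.comp_ofReal
    · have := hF.continuous
      exact (by fun_prop : Continuous fun x : ℝ => F (x + w')).intervalIntegrable _ _
  have hder : ∀ w' ∈ Metric.ball (0 : ℂ) (‖w‖ + 1),
      HasDerivAt (fun w' => Φ (1 + w') - Φ w') 0 w' := by
    intro w' hw'
    have h1 := (hΦ _ (by simpa using hmem w' hw' 1 (by simp))).comp_const_add 1 w'
    have h0 := hΦ w' (by simpa using hmem w' hw' 0 (by simp))
    have := h1.sub h0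
    rwa [add_comm 1 w', hper, sub_self] at this
  have h0 : (0 : ℂ) ∈ Metric.ball (0 : ℂ) (‖w‖ + 1) := Metric.mem_ball_self (by positivity)
  have hw : w ∈ Metric.ball (0 : ℂ) (‖w‖ + 1) := by simp
  have hconst := Metric.isOpen_ball.is_const_of_deriv_eq_zero
    (convex_ball (0 : ℂ) (‖w‖ + 1)).isPreconnected
    (fun w' hw' => (hder w' hw').differentiableAt.differentiableWithinAt)
    (fun w' hw' => (hder w' hw').deriv) hw h0
  have := (hJ w hw).trans (hconst.trans (hJ 0 h0).symm)
  simpa using this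

/-- The Fourier coefficients of a function of period `1`. -/
def periodicCoeff (p : ℂ → ℂ) (n : ℤ) : ℂ := ∫ x in (0 : ℝ)..1, p x * expTwoPiI (-(n * x))

section Fourier

variable {p : ℂ → ℂ} (hp : Differentiable ℂ p) (hper : ∀ z, p (z + 1) = p z)
include hp hper

theorem periodicCoeff_translate (n : ℤ) (w : ℂ) :
    ∫ x in (0 : ℝ)..1, p (x + w) * expTwoPiI (-(n * (x + w))) = periodicCoeff p n :=
  intervalIntegral_add_eq_of_periodic (F := fun z => p z * expTwoPiI (-(n * z)))
    (by fun_prop) (fun z => by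
      rw [hper, mul_add, neg_add, expTwoPiI_add, mul_one, expTwoPiI_neg n, expTwoPiI_int,
        inv_one, mul_one]) w

theorem periodicCoeff_comp_add (n : ℤ) (w : ℂ) :
    periodicCoeff (fun z => p (z + w)) n = expTwoPiI (n * w) * periodicCoeff p n := by
  rw [← periodicCoeff_translate hp hper n w, periodicCoeff,
    ← intervalIntegral.integral_const_mul]
  refine intervalIntegral.integral_congr fun x _ => ?_
  have h : -((n : ℂ) * x) = n * w + -(n * (x + w)) := by ring
  simp only [h, expTwoPiI_add]
  ring

/-- Moving the segment of integration to height `±R / (2π)`, with sign opposite to that of `n`,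
gains the factor `exp (-R |n|)`. Since `R` is arbitrary, the decay beats every exponential. -/
theorem norm_periodicCoeff_le (R : ℝ) : ∃ C : ℝ, 0 ≤ C ∧ ∀ n : ℤ,
    ‖periodicCoeff p n‖ ≤ C * Real.exp (-R) ^ n.natAbs := by
  set S := R / (2 * Real.pi) with hS
  obtain ⟨C, hC⟩ := (isCompact_closedBall (0 : ℂ) (1 + |S|)).exists_bound_of_continuousOn
    hp.continuous.continuousOn
  refine ⟨|C|, abs_nonneg C, fun n => ?_⟩
  have key : ∀ s : ℝ, |s| ≤ |S| → n * s * (2 * Real.pi) = - R * n.natAbs →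
      ‖periodicCoeff p n‖ ≤ |C| * Real.exp (-R) ^ n.natAbs := by
    intro s hs hns
    rw [← periodicCoeff_translate hp hper n (s * Complex.I)]
    refine (intervalIntegral.norm_integral_le_of_norm_le_const
      (C := |C| * Real.exp (-R) ^ n.natAbs) fun x hx => ?_).trans (by simp)
    rw [Set.uIoc_of_le zero_le_one] at hx
    rw [norm_mul, norm_expTwoPiI, ← Real.exp_nat_mul]
    gcongr
    · refine (hC _ ?_).trans (le_abs_self C)
      rw [mem_closedBall_zero_iff]
      refine (norm_add_le _ _).trans (add_le_add ?_ ?_)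
      · rw [Complex.norm_real, Real.norm_eq_abs, abs_of_pos hx.1]; exact hx.2
      · simpa using hs
    · have him : (-((n : ℂ) * (x + s * Complex.I))).im = -(n * s) := by simp
      rw [him]
      linarith
  have hcast : (n.natAbs : ℝ) = |(n : ℝ)| := by rw [Nat.cast_natAbs, Int.cast_abs]
  have hSR : S * (2 * Real.pi) = R := by rw [hS]; field_simp
  rcases le_total 0 n with h | h
  · refine key (-S) (by rw [abs_neg]) ?_
    rw [hcast, abs_of_nonneg (by exact_mod_cast h), mul_assoc, neg_mul, hSR]; ring
  · refine key S le_rfl ?_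
    rw [hcast, abs_of_nonpos (by exact_mod_cast h), mul_assoc, hSR]; ring

omit hp hper in
theorem summable_pow_natAbs {r : ℝ} (h0 : 0 ≤ r) (h1 : r < 1) :
    Summable fun n : ℤ => r ^ n.natAbs := by
  have h := summable_geometric_of_lt_one h0 h1
  exact Summable.of_nat_of_neg (by simpa using h) (by simpa using h)

omit hp hper in
theorem norm_expTwoPiI_int_mul_le (n : ℤ) {z : ℂ} {B : ℝ} (hz : ‖z‖ ≤ B) :
    ‖expTwoPiI (n * z)‖ ≤ Real.exp (2 * Real.pi * B) ^ n.natAbs := by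
  rw [norm_expTwoPiI, ← Real.exp_nat_mul]
  apply Real.exp_le_exp.2
  have hcast : (n.natAbs : ℝ) = |(n : ℝ)| := by rw [Nat.cast_natAbs, Int.cast_abs]
  have h1 : ((n : ℂ) * z).im = n * z.im := by simp
  have h2 : -(n * z.im) ≤ |(n : ℝ)| * B := by
    refine (neg_le_abs _).trans ?_
    rw [abs_mul]
    gcongr
    exact (Complex.abs_im_le_norm z).trans hz
  rw [h1, hcast]
  nlinarith [Real.pi_pos]

/-- Fourier series with the coefficients of an entire function converge locally uniformly. -/
theorem exists_summable_bound_periodicCoeff (B : ℝ) : ∃ u : ℤ → ℝ, Summable u ∧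
    ∀ (n : ℤ) (z : ℂ), ‖z‖ ≤ B → ‖periodicCoeff p n * expTwoPiI (n * z)‖ ≤ u n := by
  obtain ⟨C, hC0, hC⟩ := norm_periodicCoeff_le hp hper (2 * Real.pi * B + 1)
  refine ⟨fun n => C * Real.exp (-1) ^ n.natAbs,
    (summable_pow_natAbs (Real.exp_pos _).le (by simp)).mul_left C, fun n z hz => ?_⟩
  rw [norm_mul]
  calc _ ≤ C * Real.exp (-(2 * Real.pi * B + 1)) ^ n.natAbs *
        Real.exp (2 * Real.pi * B) ^ n.natAbs := by
        gcongr
        · exact hC n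
        · exact norm_expTwoPiI_int_mul_le n hz
    _ = _ := by
        rw [mul_assoc, ← mul_pow, ← Real.exp_add]
        congr 3
        ring

/-- For complex `z`, Fourier's theorem on the circle is applied to `x ↦ p (x + z)` and evaluated at
`x = 0`. -/
theorem hasSum_periodicCoeff (z : ℂ) :
    HasSum (fun n : ℤ => periodicCoeff p n * expTwoPiI (n * z)) (p z) := by
  have hP : Function.Periodic (fun x : ℝ => p (x + z)) 1 := fun x => by
    simp only [Complex.ofReal_add, Complex.ofReal_one]
    rw [add_right_comm, hper]
  let f : C(AddCircle (1 : ℝ), ℂ) := ⟨hP.lift,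
    continuous_coinduced_dom.2 (by
      have := hp.continuous
      exact (by fun_prop : Continuous fun x : ℝ => p (x + z)))⟩
  have : Fact (0 < (1 : ℝ)) := ⟨one_pos⟩
  have hcoeff : ∀ n, fourierCoeff f n = periodicCoeff p n * expTwoPiI (n * z) := by
    intro n
    rw [fourierCoeff_eq_intervalIntegral f n 0, mul_comm, ← periodicCoeff_comp_add hp hper,
      periodicCoeff]
    simp only [zero_add, div_one, one_smul]
    refine intervalIntegral.integral_congr fun x _ => ?_
    simp only [fourier_coe_apply, smul_eq_mul]
    have : f (x : AddCircle (1 : ℝ)) = p (x + z) := hP.lift_coe x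
    rw [this, mul_comm, expTwoPiI]
    congr 2
    push_cast
    ring
  obtain ⟨u, hu, h⟩ := exists_summable_bound_periodicCoeff hp hper ‖z‖
  have hs : Summable (fourierCoeff f) := by
    rw [funext hcoeff]
    exact hu.of_norm_bounded fun n => h n z le_rfl
  have h0 := has_pointwise_sum_fourier_series_of_summable hs ((0 : ℝ) : AddCircle (1 : ℝ))
  have hf0 : f ((0 : ℝ) : AddCircle (1 : ℝ)) = p z := by
    have : f ((0 : ℝ) : AddCircle (1 : ℝ)) = p ((0 : ℝ) + z) := hP.lift_coe 0
    rw [this]; simp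
  rw [hf0] at h0
  refine HasSum.congr_fun h0 ?_
  intro n
  rw [hcoeff, fourier_coe_apply]
  simp

end Fourier

/-! ### The difference equation for a second period `τ`, and doubly periodic functions. -/

section Fourier

variable {τ : ℂ} (hτ : 0 < τ.im)
include hτ

/-- There are no small divisors because `Im τ > 0`: for `n > 0` the exponential has modulus at most
`exp (-2π Im τ)`, and negative `n` reduce to this by factoring out a number of modulus at least `1`.
-/
theorem one_sub_exp_le_norm_expTwoPiI_sub_one {n : ℤ} (hn : n ≠ 0) :
    1 - Real.exp (-(2 * Real.pi * τ.im)) ≤ ‖expTwoPiI (n * τ) - 1‖ := by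
  have hpos : ∀ m : ℤ, 0 < m →
      1 - Real.exp (-(2 * Real.pi * τ.im)) ≤ ‖expTwoPiI (m * τ) - 1‖ := by
    intro m hm
    have h1 := norm_sub_norm_le (1 : ℂ) (expTwoPiI (m * τ))
    rw [norm_one, norm_sub_rev, norm_expTwoPiI] at h1
    refine le_trans ?_ h1
    have h2 : (1 : ℝ) ≤ m := by exact_mod_cast hm
    have h3 : ((m : ℂ) * τ).im = m * τ.im := by simp
    gcongr
    rw [h3]
    nlinarith
  rcases lt_or_gt_of_ne hn with h | h
  · have h1 := hpos (-n) (by omega)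
    have h2 : expTwoPiI (n * τ) - 1 =
        -(expTwoPiI (n * τ) * (expTwoPiI ((-n : ℤ) * τ) - 1)) := by
      rw [mul_sub, ← expTwoPiI_add]
      push_cast
      rw [← add_mul, add_neg_cancel, zero_mul, expTwoPiI_zero]
      ring
    rw [h2, norm_neg, norm_mul]
    have h3 : 1 ≤ ‖expTwoPiI (n * τ)‖ := by
      rw [norm_expTwoPiI]
      apply Real.one_le_exp
      have h4 : (n : ℝ) < 0 := by exact_mod_cast h
      have h5 : ((n : ℂ) * τ).im = n * τ.im := by simp
      rw [h5]
      nlinarith [mul_pos (mul_pos Real.pi_pos hτ) (neg_pos.2 h4)]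
    nlinarith [norm_nonneg (expTwoPiI ((-n : ℤ) * τ) - 1)]
  · exact hpos n h

theorem one_sub_exp_neg_pos : 0 < 1 - Real.exp (-(2 * Real.pi * τ.im)) := by
  have : Real.exp (-(2 * Real.pi * τ.im)) < 1 := by
    rw [← Real.exp_zero]
    apply Real.exp_lt_exp.2
    have := mul_pos (mul_pos two_pos Real.pi_pos) hτ
    linarith
  linarith

theorem exists_periodic_add_sub_eq {p : ℂ → ℂ} (hp : Differentiable ℂ p)
    (hper : ∀ z, p (z + 1) = p z) :
    ∃ k : ℂ → ℂ, Differentiable ℂ k ∧ (∀ z, k (z + 1) = k z) ∧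
      ∀ z, k (z + τ) - k z = p z - periodicCoeff p 0 := by
  -- Coefficientwise division by `expTwoPiI (n * τ) - 1`. For `n = 0` this is a division by zero
  -- with value `0`, so the constant term is the one left unsolved.
  set F : ℤ → ℂ → ℂ := fun n z => periodicCoeff p n / (expTwoPiI (n * τ) - 1) *
    expTwoPiI (n * z) with hF
  have hc := one_sub_exp_neg_pos hτ
  set c := 1 - Real.exp (-(2 * Real.pi * τ.im)) with hcdef
  have hbound : ∀ B : ℝ, 0 ≤ B → ∃ u : ℤ → ℝ, Summable u ∧
      ∀ n z, ‖z‖ ≤ B → ‖F n z‖ ≤ u n := by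
    intro B hB
    obtain ⟨u, hu, h⟩ := exists_summable_bound_periodicCoeff hp hper B
    refine ⟨fun n => c⁻¹ * u n, hu.mul_left _, fun n z hz => ?_⟩
    have h1 := h n z hz
    rw [norm_mul] at h1
    simp only [hF, norm_mul, norm_div]
    by_cases hn : n = 0
    · subst hn
      simp only [Int.cast_zero, zero_mul, expTwoPiI_zero, sub_self, norm_zero, div_zero]
      exact mul_nonneg (inv_nonneg.2 hc.le) (le_trans (by positivity) h1)
    · have h2 := one_sub_exp_le_norm_expTwoPiI_sub_one hτ hn
      rw [div_eq_inv_mul, mul_assoc]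
      gcongr
  have hsum : ∀ z, Summable fun n => F n z := by
    intro z
    obtain ⟨u, hu, h⟩ := hbound ‖z‖ (norm_nonneg z)
    exact hu.of_norm_bounded fun n => h n z le_rfl
  refine ⟨fun z => ∑' n, F n z, fun z => ?_, fun z => ?_, fun z => ?_⟩
  · obtain ⟨u, hu, h⟩ := hbound (‖z‖ + 1) (by positivity)
    refine (Complex.differentiableOn_tsum_of_summable_norm (U := Metric.ball 0 (‖z‖ + 1)) hu
      (fun n => ?_) Metric.isOpen_ball
      fun n w hw => h n w (by simpa using (Metric.mem_ball.1 hw).le)).differentiableAt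
        (Metric.isOpen_ball.mem_nhds (by simp))
    exact (by fun_prop : Differentiable ℂ (F n)).differentiableOn
  · refine tsum_congr fun n => ?_
    simp only [hF]
    rw [mul_add, expTwoPiI_add, mul_one, expTwoPiI_int, mul_one]
  · refine ((hsum (z + τ)).hasSum.sub (hsum z).hasSum).unique ?_
    have h1 := (hasSum_periodicCoeff hp hper z).sub (hasSum_ite_eq 0 (periodicCoeff p 0))
    refine HasSum.congr_fun h1 ?_
    intro n
    simp only [hF]
    by_cases hn : n = 0
    · subst hn
      simp [expTwoPiI_zero]
    · have h2 : expTwoPiI (n * τ) - 1 ≠ 0 := by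
        intro h0
        have := one_sub_exp_le_norm_expTwoPiI_sub_one hτ hn
        rw [h0, norm_zero] at this
        linarith
      rw [if_neg hn, mul_add, expTwoPiI_add]
      field_simp
      ring

/-- The period `τ` gives `(expTwoPiI (n * τ) - 1) * periodicCoeff g n = 0`, which kills every
Fourier coefficient except that of index `0`. -/
theorem eq_const_of_doubly_periodic {g : ℂ → ℂ} (hg : Differentiable ℂ g)
    (h1 : ∀ z, g (z + 1) = g z) (h2 : ∀ z, g (z + τ) = g z) (z : ℂ) : g z = g 0 := by
  have hc : ∀ n : ℤ, n ≠ 0 → periodicCoeff g n = 0 := by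
    intro n hn
    have h := periodicCoeff_comp_add hg h1 n τ
    rw [funext h2] at h
    have h3 : (expTwoPiI (n * τ) - 1) * periodicCoeff g n = 0 := by
      rw [sub_mul, ← h, one_mul, sub_self]
    refine (mul_eq_zero.1 h3).resolve_left fun h0 => ?_
    have := one_sub_exp_le_norm_expTwoPiI_sub_one hτ hn
    rw [h0, norm_zero] at this
    linarith [one_sub_exp_neg_pos hτ]
  have h : ∀ z, g z = periodicCoeff g 0 := by
    intro z
    refine (hasSum_periodicCoeff hg h1 z).unique ?_
    have := hasSum_single (f := fun n : ℤ => periodicCoeff g n * expTwoPiI (n * z)) 0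
      fun n hn => by rw [hc n hn, zero_mul]
    simpa [expTwoPiI_zero] using this
  rw [h z, h 0]

end Fourier

/-! ### Cocycles with respect to two independent periods. -/

section TwoPeriods

variable {l₁ l₂ : ℂ} (hl : 0 < (l₂ / l₁).im)
include hl

theorem period_ne_zero : l₁ ≠ 0 := by
  rintro rfl
  simp at hl

/-- An additive cocycle of entire functions is cohomologous to a constant one. -/
theorem exists_primitive_of_cocycle {g₁ g₂ : ℂ → ℂ} (hg₁ : Differentiable ℂ g₁)
    (hg₂ : Differentiable ℂ g₂) (h : ∀ z, g₁ (z + l₂) - g₁ z = g₂ (z + l₁) - g₂ z) :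
    ∃ (k : ℂ → ℂ) (c : ℂ), Differentiable ℂ k ∧ (∀ z, k (z + l₁) - k z = g₁ z) ∧
      ∀ z, k (z + l₂) - k z = g₂ z - c := by
  have hl₁ := period_ne_zero hl
  have hscale : ∀ z, l₁ * (z + l₂ / l₁) = l₁ * z + l₂ := fun z => by field_simp
  -- After rescaling to the periods `1` and `l₂ / l₁`, `k` removes `g₁`. The cocycle identity makes
  -- what remains of `g₂` periodic, so that it can be removed up to its mean, the constant `c`.
  obtain ⟨k, hk, hk1⟩ := exists_entire_add_one_sub_eq (f := fun z => g₁ (l₁ * z)) (by fun_prop)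
  obtain ⟨m, hm, hm1, hm2⟩ := exists_periodic_add_sub_eq hl
    (p := fun z => g₂ (l₁ * z) - (k (z + l₂ / l₁) - k z)) (by fun_prop) (fun z => by
      have e1 := hk1 (z + l₂ / l₁)
      have e2 := hk1 z
      have e3 := h (l₁ * z)
      rw [hscale] at e1
      rw [add_right_comm z 1, mul_add l₁ z 1, mul_one]
      linear_combination e2 - e1 - e3)
  set c := periodicCoeff (fun z => g₂ (l₁ * z) - (k (z + l₂ / l₁) - k z)) 0
  refine ⟨fun z => k (z / l₁) + m (z / l₁), c, by fun_prop, fun z => ?_, fun z => ?_⟩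
  · have e1 := hk1 (z / l₁)
    simp only [mul_div_cancel₀ z hl₁] at e1
    simp only [add_div, div_self hl₁, hm1]
    linear_combination e1
  · have e2 := hm2 (z / l₁)
    simp only [mul_div_cancel₀ z hl₁] at e2
    simp only [add_div]
    linear_combination e2

/-- A nowhere vanishing entire function that is multiplied by constants under two independent
translations is an exponential. -/
theorem eq_exp_of_multiplicative {h : ℂ → ℂ} (hh : Differentiable ℂ h) (h0 : ∀ z, h z ≠ 0)
    {C₁ C₂ : ℂ} (h1 : ∀ z, h (z + l₁) = C₁ * h z) (h2 : ∀ z, h (z + l₂) = C₂ * h z) :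
    ∃ k : ℂ, ∀ z, h z = h 0 * expTwoPiI (k * z) := by
  have hl₁ := period_ne_zero hl
  have hscale : ∀ z, l₁ * (z + l₂ / l₁) = l₁ * z + l₂ := fun z => by field_simp
  have hd : Differentiable ℂ (deriv h) := hh.deriv
  have hlog : ∀ {l C : ℂ}, (∀ z, h (z + l) = C * h z) → ∀ z,
      deriv h (z + l) / h (z + l) = deriv h z / h z := by
    intro l C hC z
    have hC0 : C ≠ 0 := by
      rintro rfl
      exact h0 (0 + l) (by rw [hC, zero_mul])
    have h3 : deriv h (z + l) = C * deriv h z := by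
      rw [← deriv_comp_add_const, funext hC, deriv_const_mul _ (hh z)]
    rw [h3, hC, mul_div_mul_left _ _ hC0]
  have hconst := eq_const_of_doubly_periodic hl (g := fun z => deriv h (l₁ * z) / h (l₁ * z))
    (Differentiable.div (by fun_prop) (by fun_prop) fun z => h0 _)
    (fun z => by rw [mul_add, mul_one, hlog h1]) (fun z => by rw [hscale, hlog h2])
  have hconst' : ∀ z, deriv h z / h z = deriv h 0 / h 0 := by
    intro z
    have := hconst (z / l₁)
    simpa [mul_div_cancel₀ z hl₁] using this
  set a := deriv h 0 / h 0 with ha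
  have hder : ∀ z, deriv h z = a * h z := fun z => by rw [← hconst' z, div_mul_cancel₀ _ (h0 z)]
  refine ⟨a / (2 * Real.pi * Complex.I), fun z => ?_⟩
  have hc := is_const_of_deriv_eq_zero (f := fun z => h z * Complex.exp (-(a * z)))
    (by fun_prop) (fun z => by
      have e1 : HasDerivAt h (a * h z) z := hder z ▸ (hh z).hasDerivAt
      have e2 : HasDerivAt (fun z => Complex.exp (-(a * z))) (Complex.exp (-(a * z)) * -a) z := by
        simpa using ((hasDerivAt_id z).const_mul a).neg.cexp
      refine (e1.mul e2).deriv.trans ?_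
      ring) z 0
  simp only [mul_zero, neg_zero, Complex.exp_zero, mul_one, Complex.exp_neg] at hc
  rw [← hc, expTwoPiI, ← mul_assoc, mul_div_cancel₀ _ Complex.two_pi_I_ne_zero, mul_assoc,
    inv_mul_cancel₀ (Complex.exp_ne_zero _), mul_one]

end TwoPeriods

/-! ### Bases dual to evaluation at points. -/

/-- A space of functions of dimension `d` has a basis that is dual to the evaluations at `d`
points. -/
theorem exists_basis_dual_to_points {X : Type*} {d : ℕ} (S : Submodule ℂ (X → ℂ))
    [FiniteDimensional ℂ S] (hS : Module.finrank ℂ S = d) :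
    ∃ (ψ : Fin d → X → ℂ) (u : Fin d → X), (∀ i, ψ i ∈ S) ∧
      (∀ i j, ψ i (u j) = if i = j then 1 else 0) ∧
      ∀ f ∈ S, ∀ x, f x = ∑ i, f (u i) * ψ i x := by
  let ev : X → Module.Dual ℂ S := fun x => (LinearMap.proj x).comp S.subtype
  obtain ⟨n, hn, f, hf, hspan⟩ : ∃ n ≤ d, ∃ f : Fin n → Module.Dual ℂ S,
      (∀ i, f i ∈ Set.range ev) ∧
      Submodule.span ℂ (Set.range f) = Submodule.span ℂ (Set.range ev) := by
    obtain ⟨f, hf, hspan, -⟩ := Submodule.exists_fun_fin_finrank_span_eq ℂ (Set.range ev)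
    refine ⟨_, ?_, f, hf, hspan⟩
    rw [← hS, ← Subspace.dual_finrank_eq (K := ℂ) (V := S)]
    exact Submodule.finrank_le _
  let E : S →ₗ[ℂ] (Fin n → ℂ) := LinearMap.pi f
  -- A function killed by the selected evaluations is killed by all of them, hence zero. Injectivity
  -- forces the number `n` of evaluations to be `d`.
  have hE : Function.Injective E := by
    rw [← LinearMap.ker_eq_bot, LinearMap.ker_eq_bot']
    intro s hs
    have h1 : ∀ φ ∈ Submodule.span ℂ (Set.range f), φ s = 0 := by
      intro φ hφ
      induction hφ using Submodule.span_induction with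
      | mem φ hφ => obtain ⟨i, rfl⟩ := hφ; exact congrFun hs i
      | zero => rfl
      | add φ φ' _ _ h h' => rw [LinearMap.add_apply, h, h', add_zero]
      | smul c φ _ h => rw [LinearMap.smul_apply, h, smul_zero]
    refine Subtype.ext (funext fun x => ?_)
    exact h1 (ev x) (by rw [hspan]; exact Submodule.subset_span ⟨x, rfl⟩)
  have hnd : n = d := by
    refine le_antisymm hn ?_
    rw [← hS]
    simpa using LinearMap.finrank_le_finrank_of_injective hE
  subst hnd
  choose u hu using hf
  have hEu : ∀ (s : S) i, E s i = s.1 (u i) := fun s i => by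
    change f i s = _
    rw [← hu]; rfl
  let e : S ≃ₗ[ℂ] (Fin n → ℂ) := LinearEquiv.ofInjectiveOfFinrankEq E hE (by simp [hS])
  have he : ∀ s, e s = E s := fun s => rfl
  refine ⟨fun i => (e.symm (Pi.single i 1)).1, u, fun i => (e.symm _).2, fun i j => ?_,
    fun g hg x => ?_⟩
  · beta_reduce
    rw [← hEu, ← he, e.apply_symm_apply, Pi.single_apply]
    exact if_congr eq_comm rfl rfl
  · have h1 : (⟨g, hg⟩ : S) = ∑ i, g (u i) • e.symm (Pi.single i 1) := by
      apply e.injective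
      ext j
      rw [map_sum]
      simp only [map_smul, LinearEquiv.apply_symm_apply, Finset.sum_apply, Pi.smul_apply,
        Pi.single_apply, smul_eq_mul, mul_ite, mul_one, mul_zero]
      rw [he, hEu]
      simp
    have h2 := congrArg (fun s : S => s.1 x) h1
    simpa [AddSubmonoidClass.coe_finsetSum] using h2

/-! ### Theta functions with periods `1` and `τ`. -/

/-- The space of theta functions of degree `d` with periods `1` and `τ`. -/
def thetaSpace (τ : ℂ) (d : ℕ) (s : ℂ) : Submodule ℂ (ℂ → ℂ) where
  carrier := {ψ | Differentiable ℂ ψ ∧ (∀ z, ψ (z + 1) = ψ z) ∧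
    ∀ z, ψ (z + τ) = expTwoPiI (s - d * z) * ψ z}
  zero_mem' := ⟨differentiable_const 0, fun _ => rfl, fun _ => (mul_zero _).symm⟩
  add_mem' := fun {f g} hf hg => ⟨hf.1.add hg.1, fun z => by
    rw [Pi.add_apply, hf.2.1, hg.2.1, Pi.add_apply], fun z => by
    rw [Pi.add_apply, hf.2.2, hg.2.2, Pi.add_apply, mul_add]⟩
  smul_mem' := fun c f hf => ⟨hf.1.const_smul c, fun z => by
    rw [Pi.smul_apply, hf.2.1, Pi.smul_apply], fun z => by
    rw [Pi.smul_apply, hf.2.2, Pi.smul_apply, smul_eq_mul, smul_eq_mul, mul_left_comm]⟩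

theorem intervalIntegrable_periodicCoeff {p : ℂ → ℂ} (hp : Differentiable ℂ p) (n : ℤ) :
    IntervalIntegrable (fun x : ℝ => p x * expTwoPiI (-(n * x))) MeasureTheory.volume 0 1 := by
  have := hp.continuous
  exact (by fun_prop : Continuous fun x : ℝ => p x * expTwoPiI (-(n * x))).intervalIntegrable _ _

/-- The Fourier coefficients with index `0, …, d - 1` of a theta function of degree `d`. -/
def thetaCoeff (τ : ℂ) (d : ℕ) (s : ℂ) : thetaSpace τ d s →ₗ[ℂ] (Fin d → ℂ) where
  toFun ψ i := periodicCoeff ψ.1 (i : ℕ)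
  map_add' ψ χ := by
    ext i
    rw [Pi.add_apply, periodicCoeff, periodicCoeff, periodicCoeff,
      ← intervalIntegral.integral_add (intervalIntegrable_periodicCoeff ψ.2.1 _)
        (intervalIntegrable_periodicCoeff χ.2.1 _)]
    simp only [Submodule.coe_add, Pi.add_apply, add_mul]
  map_smul' c ψ := by
    ext i
    rw [RingHom.id_apply, Pi.smul_apply, periodicCoeff, periodicCoeff, smul_eq_mul,
      ← intervalIntegral.integral_const_mul]
    simp only [Submodule.coe_smul, Pi.smul_apply, smul_eq_mul, mul_assoc]

/-- Comparing the Fourier coefficients of both sides of the functional equation under `τ` gives a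
recursion with nonzero factors, so the coefficients of index `0, …, d - 1` determine the function.
-/
theorem periodicCoeff_add_degree {τ : ℂ} {d : ℕ} {s : ℂ} {ψ : ℂ → ℂ}
    (hψ : ψ ∈ thetaSpace τ d s) (n : ℤ) :
    expTwoPiI (n * τ) * periodicCoeff ψ n = expTwoPiI s * periodicCoeff ψ (n + d) := by
  rw [← periodicCoeff_comp_add hψ.1 hψ.2.1, periodicCoeff, periodicCoeff,
    ← intervalIntegral.integral_const_mul]
  refine intervalIntegral.integral_congr fun x _ => ?_
  simp only [hψ.2.2]
  have h : -(((n + d : ℤ) : ℂ) * x) = -(d * x) + -(n * x) := by push_cast; ring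
  rw [h, sub_eq_add_neg, expTwoPiI_add, expTwoPiI_add]
  ring

theorem eq_zero_of_thetaCoeff_eq_zero {τ : ℂ} {d : ℕ} (hd : 0 < d) {s : ℂ} {ψ : ℂ → ℂ}
    (hψ : ψ ∈ thetaSpace τ d s) (h : ∀ i : Fin d, periodicCoeff ψ (i : ℕ) = 0) : ψ = 0 := by
  have hstep : ∀ n : ℤ, periodicCoeff ψ n = 0 ↔ periodicCoeff ψ (n + d) = 0 := by
    intro n
    have := periodicCoeff_add_degree hψ n
    constructor
    · intro h0
      rw [h0, mul_zero] at this
      exact (mul_eq_zero.1 this.symm).resolve_left (expTwoPiI_ne_zero _)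
    · intro h0
      rw [h0, mul_zero] at this
      exact (mul_eq_zero.1 this).resolve_left (expTwoPiI_ne_zero _)
  have hall : ∀ (i : Fin d) (k : ℤ), periodicCoeff ψ ((i : ℕ) + d * k) = 0 := by
    intro i k
    induction k using Int.induction_on with
    | zero => simpa using h i
    | succ k ih => rw [hstep] at ih; convert ih using 2; ring
    | pred k ih => rw [hstep]; convert ih using 2; ring
  have hzero : ∀ n : ℤ, periodicCoeff ψ n = 0 := by
    intro n
    have hd' : (0 : ℤ) < d := by exact_mod_cast hd
    have h1 := Int.emod_nonneg n hd'.ne'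
    have h2 := Int.emod_lt_of_pos n hd'
    have h3 := hall ⟨(n % d).toNat, by omega⟩ (n / d)
    rwa [Int.toNat_of_nonneg h1, Int.emod_add_mul_ediv] at h3
  funext z
  refine (hasSum_periodicCoeff hψ.1 hψ.2.1 z).unique ?_
  simp only [hzero, zero_mul]
  exact hasSum_zero

theorem integral_exp_int_mul_eq_zero {m : ℤ} (hm : m ≠ 0) :
    ∫ x in (0 : ℝ)..1, Complex.exp (2 * Real.pi * Complex.I * m * x) = 0 := by
  have h : (2 * Real.pi * Complex.I * m : ℂ) ≠ 0 :=
    mul_ne_zero Complex.two_pi_I_ne_zero (by exact_mod_cast hm)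
  rw [integral_exp_mul_complex h]
  have h1 : Complex.exp (2 * Real.pi * Complex.I * m) = 1 := expTwoPiI_int m
  simp [h1]

/-- Integrating the series over `[0, 1]` leaves only the term of index `0`, which is `1`; a
vanishing function would give `0`. -/
theorem exists_jacobiTheta₂_ne_zero {τ : ℂ} (hτ : 0 < τ.im) : ∃ z, jacobiTheta₂ z τ ≠ 0 := by
  by_contra! hall
  let f : ℤ → C(ℝ, ℂ) := fun n => ⟨fun x => jacobiTheta₂_term n x τ, by
    unfold jacobiTheta₂_term; fun_prop⟩
  have hsum : Summable fun n => ‖(f n).restrict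
      (⟨Set.uIcc 0 1, isCompact_uIcc⟩ : TopologicalSpace.Compacts ℝ)‖ := by
    refine Summable.of_nonneg_of_le (fun n => norm_nonneg _) (fun n => ?_)
      ((summable_jacobiTheta₂_term_iff 0 τ).2 hτ).norm
    refine (ContinuousMap.norm_le _ (norm_nonneg _)).2 fun x => le_of_eq ?_
    change ‖jacobiTheta₂_term n (x : ℝ) τ‖ = _
    rw [norm_jacobiTheta₂_term, norm_jacobiTheta₂_term]
    simp
  have h := intervalIntegral.hasSum_intervalIntegral_of_summable_norm (a := 0) (b := 1) hsum
  have h0 : ∀ x : ℝ, ∑' n, f n x = 0 := fun x => hall x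
  simp only [h0, intervalIntegral.integral_zero] at h
  have h1 : ∀ n : ℤ, n ≠ 0 → ∫ x in (0 : ℝ)..1, f n x = 0 := by
    intro n hn
    have h2 : ∀ x : ℝ, f n x = Complex.exp (2 * Real.pi * Complex.I * n * x) *
        Complex.exp (Real.pi * Complex.I * n ^ 2 * τ) := fun x => Complex.exp_add _ _
    simp only [h2, intervalIntegral.integral_mul_const, integral_exp_int_mul_eq_zero hn, zero_mul]
  have h3 : ∫ x in (0 : ℝ)..1, f 0 x = 1 := by
    have h2 : ∀ x : ℝ, f 0 x = 1 := fun x => by simp [f, jacobiTheta₂_term]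
    simp [h2]
  have h4 := hasSum_single (f := fun n : ℤ => ∫ x in (0 : ℝ)..1, f n x) 0 h1
  rw [h3] at h4
  exact zero_ne_one (h.unique h4)

/-- The theta function of degree `d` whose Fourier coefficients are supported on `j + d ℤ`. -/
def thetaBasis (τ : ℂ) (d : ℕ) (s : ℂ) (j : ℕ) (z : ℂ) : ℂ :=
  expTwoPiI (j * z) * jacobiTheta₂ (d * z + (j * τ - s - d * τ / 2)) (d * τ)

section

variable {τ : ℂ} (hτ : 0 < τ.im) {d : ℕ} (hd : 0 < d) (s : ℂ) (j : ℕ)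
include hτ hd

theorem degree_mul_im_pos : 0 < ((d : ℂ) * τ).im := by
  have : (0 : ℝ) < d := by exact_mod_cast hd
  have h : ((d : ℂ) * τ).im = d * τ.im := by simp
  rw [h]
  positivity

theorem thetaBasis_mem : thetaBasis τ d s j ∈ thetaSpace τ d s := by
  have hdτ := degree_mul_im_pos hτ hd
  refine ⟨?_, fun z => ?_, fun z => ?_⟩
  · have h : Differentiable ℂ fun z => jacobiTheta₂ z (d * τ) := fun z =>
      differentiableAt_jacobiTheta₂_fst z hdτ
    unfold thetaBasis
    fun_prop
  · have hper : Function.Periodic (fun z => jacobiTheta₂ z (d * τ)) 1 := fun z =>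
      jacobiTheta₂_add_left z _
    have h := hper.nat_mul d (d * z + (j * τ - s - d * τ / 2))
    simp only [mul_one] at h
    rw [thetaBasis, thetaBasis, mul_add, mul_one, mul_add, mul_one, expTwoPiI_add,
      add_right_comm, h]
    rw [show ((j : ℕ) : ℂ) = ((j : ℤ) : ℂ) by push_cast; rfl, expTwoPiI_int, mul_one]
  · rw [thetaBasis, thetaBasis, mul_add (d : ℂ), add_right_comm, jacobiTheta₂_add_left',
      mul_left_comm, ← mul_assoc, ← mul_assoc]
    congr 1
    -- The shift `j * τ - s - d * τ / 2` in `thetaBasis` is chosen for this identity; the surplus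
    -- `-j * τ` is absorbed by the factor `expTwoPiI (j * z)`.
    have h : Complex.exp (-Real.pi * Complex.I *
        (d * τ + 2 * (d * z + (j * τ - s - d * τ / 2)))) = expTwoPiI (s - d * z - j * τ) := by
      rw [expTwoPiI]
      congr 1
      ring
    rw [h, ← expTwoPiI_add, ← expTwoPiI_add]
    congr 1
    ring

theorem thetaBasis_ne_zero : thetaBasis τ d s j ≠ 0 := by
  obtain ⟨z, hz⟩ := exists_jacobiTheta₂_ne_zero (degree_mul_im_pos hτ hd)
  intro h
  have hd' : (d : ℂ) ≠ 0 := by exact_mod_cast hd.ne'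
  have h0 := congrFun h ((z - (j * τ - s - d * τ / 2)) / d)
  rw [thetaBasis, mul_div_cancel₀ _ hd', sub_add_cancel] at h0
  exact (mul_ne_zero (expTwoPiI_ne_zero _) hz) h0

/-- Translation by `1 / d` multiplies the function by a `d`-th root of unity given by `j`, but its
`i`-th coefficient by the one given by `i`; a nonzero coefficient forces `i ≡ j` modulo `d`. -/
theorem periodicCoeff_thetaBasis {i j : Fin d} (hij : i ≠ j) :
    periodicCoeff (thetaBasis τ d s j) (i : ℕ) = 0 := by
  have hd' : (d : ℂ) ≠ 0 := by exact_mod_cast hd.ne'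
  have hmem := thetaBasis_mem hτ hd s j
  have h1 := periodicCoeff_comp_add hmem.1 hmem.2.1 (i : ℕ) (1 / d)
  have h2 : ∀ z, thetaBasis τ d s j (z + 1 / d) =
      expTwoPiI ((j : ℕ) * (1 / d)) * thetaBasis τ d s j z := by
    intro z
    rw [thetaBasis, mul_add (d : ℂ), mul_one_div_cancel hd', add_right_comm,
      jacobiTheta₂_add_left, mul_add, expTwoPiI_add, thetaBasis]
    ring
  have h3 : periodicCoeff (fun z => thetaBasis τ d s j (z + 1 / d)) (i : ℕ) =
      expTwoPiI ((j : ℕ) * (1 / d)) * periodicCoeff (thetaBasis τ d s j) (i : ℕ) := by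
    simp only [h2]
    rw [periodicCoeff, periodicCoeff, ← intervalIntegral.integral_const_mul]
    simp only [mul_assoc]
  rw [h3] at h1
  by_contra hne
  have h4 := mul_right_cancel₀ hne h1
  have h5 : expTwoPiI (((j : ℕ) : ℂ) * (1 / d) - ((i : ℕ) : ℤ) * (1 / d)) = 1 := by
    rw [expTwoPiI_sub, h4, div_self (expTwoPiI_ne_zero _)]
  obtain ⟨m, hm⟩ := expTwoPiI_eq_one_iff.1 h5
  have h6 : ((j : ℕ) : ℤ) - (i : ℕ) = m * d := by
    field_simp at hm
    rw [mul_comm m]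
    exact_mod_cast hm
  have hi := i.2
  have hj := j.2
  have hm0 : m = 0 := by
    have a1 : m * d < 1 * d := by omega
    have a2 : (-1) * (d : ℤ) < m * d := by omega
    have a3 := lt_of_mul_lt_mul_right a1 (by omega)
    have a4 := lt_of_mul_lt_mul_right a2 (by omega)
    omega
  rw [hm0, zero_mul] at h6
  exact hij (Fin.ext (by omega))

theorem bijective_thetaCoeff : Function.Bijective (thetaCoeff τ d s) := by
  constructor
  · rw [← LinearMap.ker_eq_bot, LinearMap.ker_eq_bot']
    intro ψ hψ
    exact Subtype.ext (eq_zero_of_thetaCoeff_eq_zero hd ψ.2 fun i => congrFun hψ i)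
  · intro v
    -- Were this coefficient zero too, all `d` determining coefficients would vanish, and with them
    -- the function.
    have hne : ∀ j : Fin d, periodicCoeff (thetaBasis τ d s j) (j : ℕ) ≠ 0 := by
      intro j h0
      refine thetaBasis_ne_zero hτ hd s j (eq_zero_of_thetaCoeff_eq_zero hd
        (thetaBasis_mem hτ hd s j) fun i => ?_)
      by_cases hij : i = j
      · rw [hij, h0]
      · exact periodicCoeff_thetaBasis hτ hd s hij
    refine ⟨∑ j : Fin d, (v j / periodicCoeff (thetaBasis τ d s j) (j : ℕ)) •
      ⟨thetaBasis τ d s j, thetaBasis_mem hτ hd s j⟩, ?_⟩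
    ext i
    rw [map_sum, Finset.sum_apply, Finset.sum_eq_single i]
    · rw [map_smul, Pi.smul_apply, smul_eq_mul]
      exact div_mul_cancel₀ _ (hne i)
    · intro j _ hji
      rw [map_smul, Pi.smul_apply]
      change _ • periodicCoeff (thetaBasis τ d s j) (i : ℕ) = 0
      rw [periodicCoeff_thetaBasis hτ hd s hji.symm, smul_zero]
    · simp

theorem exists_theta_dual_to_points : ∃ (ψ : Fin d → ℂ → ℂ) (u : Fin d → ℂ),
    (∀ i, ψ i ∈ thetaSpace τ d s) ∧ (∀ i j, ψ i (u j) = if i = j then 1 else 0) ∧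
      ∀ f ∈ thetaSpace τ d s, ∀ x, f x = ∑ i, f (u i) * ψ i x := by
  let e := LinearEquiv.ofBijective _ (bijective_thetaCoeff hτ hd s)
  have : FiniteDimensional ℂ (thetaSpace τ d s) := e.symm.finiteDimensional
  exact exists_basis_dual_to_points _ (by rw [e.finrank_eq]; simp)

end

namespace TorusBundles

set_option linter.unusedSectionVars false

/-! ### Direct images with a frame that is global over the universal cover of the base. -/

section Relative

variable {V W X : Type} [NormedAddCommGroup V] [NormedSpace ℂ V]
  [NormedAddCommGroup W] [NormedSpace ℂ W] [NormedAddCommGroup X] [NormedSpace ℂ X]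
  {Λ : AddSubgroup V} {Λ' : AddSubgroup W} {Λ'' : AddSubgroup X}

theorem LineBundle.e_zero (L : LineBundle Λ) (v : V) : L.e 0 v = 1 := by
  have h := L.cocycle 0 0 v
  simp only [add_zero, AddSubgroup.coe_zero] at h
  exact (mul_eq_left₀ (L.ne_zero 0 v)).1 h.symm

theorem isOpen_preim {U : Set (V ⧸ Λ)} (hU : IsOpen U) : IsOpen (preim Λ U) :=
  hU.preimage continuous_quot_mk

theorem continuous_torusMap (f : TorusMap Λ'' Λ') : Continuous f.map :=
  continuous_coinduced_dom.2 (continuous_quot_mk.comp f.holo.continuous)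

/-- The pair of two lattice vectors. -/
def latticePair (l : Λ) (n : Λ') : Λ.prod Λ' :=
  ⟨(l, n), AddSubgroup.mem_prod.2 ⟨l.2, n.2⟩⟩

namespace LineBundle

variable (𝓛 : LineBundle (Λ.prod Λ'))

theorem sliceSections_add {x : W ⧸ Λ'} (t : 𝓛.sliceSections x) (n : Λ') (z : V)
    {w w' : Over Λ' x} (h : w'.1 = w.1 + n) :
    t.1 z w' = 𝓛.e (latticePair 0 n) (z, w.1) * t.1 z w := by
  have := t.2.2 (latticePair 0 n) z w w' h
  rwa [show z + (latticePair (0 : Λ) n).1.1 = z from add_zero z] at this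

/-- The holomorphic functions on `V` with the multipliers of the restriction of `𝓛` to the slice
over `w`. -/
def sliceFunctions (w : W) : Submodule ℂ (V → ℂ) where
  carrier := {f | Differentiable ℂ f ∧
    ∀ (l : Λ) (z : V), f (z + l) = 𝓛.e (latticePair l 0) (z, w) * f z}
  zero_mem' := ⟨differentiable_const 0, fun _ _ => (mul_zero _).symm⟩
  add_mem' := fun {f g} hf hg => ⟨hf.1.add hg.1, fun l z => by
    rw [Pi.add_apply, hf.2, hg.2, Pi.add_apply, mul_add]⟩
  smul_mem' := fun c f hf => ⟨hf.1.const_smul c, fun l z => by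
    rw [Pi.smul_apply, hf.2, Pi.smul_apply, smul_eq_mul, smul_eq_mul, mul_left_comm]⟩

theorem over_sub_mem {x : W ⧸ Λ'} (w w' : Over Λ' x) : w'.1 - w.1 ∈ Λ' := by
  have h : (w.1 : W ⧸ Λ') = w'.1 := w.2.trans w'.2.symm
  rw [QuotientAddGroup.eq] at h
  rwa [sub_eq_neg_add]

/-- A section over a slice is determined by its values on one copy of `V` in `V × W`. -/
def sliceEquiv {x : W ⧸ Λ'} (w : Over Λ' x) : 𝓛.sliceSections x ≃ₗ[ℂ] 𝓛.sliceFunctions w.1 where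
  toFun t := ⟨fun z => t.1 z w, t.2.1 w, fun l z => t.2.2 (latticePair l 0) z w w
    (add_zero w.1).symm⟩
  map_add' _ _ := rfl
  map_smul' _ _ := rfl
  invFun f := ⟨fun z w' => 𝓛.e (latticePair 0 ⟨w'.1 - w.1, over_sub_mem w w'⟩) (z, w.1) * f.1 z,
    fun w' => by
      have h1 := 𝓛.holo (latticePair 0 ⟨w'.1 - w.1, over_sub_mem w w'⟩)
      have h2 := f.2.1
      fun_prop,
    fun l z w' w'' h => by
      obtain ⟨⟨l, n⟩, hln⟩ := l
      have hl := (AddSubgroup.mem_prod.1 hln).1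
      have hn := (AddSubgroup.mem_prod.1 hln).2
      have h1 := 𝓛.cocycle (latticePair 0 ⟨w''.1 - w.1, over_sub_mem w w''⟩)
        (latticePair ⟨l, hl⟩ 0) (z, w.1)
      have h2 := 𝓛.cocycle (latticePair ⟨l, hl⟩ ⟨n, hn⟩)
        (latticePair 0 ⟨w'.1 - w.1, over_sub_mem w w'⟩) (z, w.1)
      -- The equivariance of the extension comes from evaluating the cocycle on one lattice vector
      -- decomposed in two ways.
      have h3 : (latticePair 0 ⟨w''.1 - w.1, over_sub_mem w w''⟩ + latticePair ⟨l, hl⟩ 0 :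
          Λ.prod Λ') = latticePair ⟨l, hl⟩ ⟨n, hn⟩ +
            latticePair 0 ⟨w'.1 - w.1, over_sub_mem w w'⟩ := by
        refine Subtype.ext (Prod.ext (add_comm _ _) ?_)
        change w''.1 - w.1 + 0 = n + (w'.1 - w.1)
        rw [h]
        change w'.1 + n - w.1 + 0 = _
        abel
      have h4 : (z, w.1) + ((latticePair ⟨l, hl⟩ 0 : Λ.prod Λ') : V × W) = (z + l, w.1) :=
        Prod.ext rfl (add_zero _)
      have h5 : (z, w.1) + ((latticePair 0 ⟨w'.1 - w.1, over_sub_mem w w'⟩ : Λ.prod Λ') : V × W) =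
          (z, w'.1) := Prod.ext (add_zero _) (add_sub_cancel _ _)
      rw [h4] at h1
      rw [h5, ← h3, h1] at h2
      change _ * f.1 (z + (⟨l, hl⟩ : Λ)) = _
      rw [f.2.2 ⟨l, hl⟩ z, ← mul_assoc, h2, mul_assoc]
      rfl⟩
  left_inv t := by
    refine Subtype.ext (funext fun z => funext fun w' => ?_)
    exact (𝓛.sliceSections_add t _ z (by simp)).symm
  right_inv f := by
    refine Subtype.ext (funext fun z => ?_)
    have h : (⟨w.1 - w.1, over_sub_mem w w⟩ : Λ') = 0 := Subtype.ext (sub_self _)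
    change 𝓛.e (latticePair 0 ⟨w.1 - w.1, over_sub_mem w w⟩) (z, w.1) * f.1 z = f.1 z
    rw [h, show (latticePair 0 0 : Λ.prod Λ') = 0 from rfl, 𝓛.e_zero, one_mul]

/-- Jointly holomorphic functions `θ i` on `V × W` that form, for every `w`, a basis of the
functions with the multipliers of `𝓛` on the slice over `w`, where the coordinates with respect to
this basis are the values at the points `p i w` multiplied by `q i w`. -/
structure RelFrame (r : ℕ) where
  θ : Fin r → V → W → ℂ
  p : Fin r → W → V
  q : Fin r → W → ℂ
  differentiable_θ : ∀ i, Differentiable ℂ fun x : V × W => θ i x.1 x.2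
  differentiable_p : ∀ i, Differentiable ℂ (p i)
  differentiable_q : ∀ i, Differentiable ℂ (q i)
  θ_add : ∀ i (l : Λ) z w, θ i (z + l) w = 𝓛.e (latticePair l 0) (z, w) * θ i z w
  dual : ∀ i j w, θ i (p j w) w * q j w = if i = j then 1 else 0
  span : ∀ w, ∀ f ∈ 𝓛.sliceFunctions w, ∀ z, f z = ∑ i, f (p i w) * q i w * θ i z w

namespace RelFrame

variable {𝓛} {r : ℕ} (F : 𝓛.RelFrame r)

/-- The pullback of a relative frame under `Id × f`. -/
def pullback (f : TorusMap Λ'' Λ') : (𝓛.pullback (idProd Λ f)).RelFrame r where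
  θ i z w := F.θ i z (f.lift w)
  p i w := F.p i (f.lift w)
  q i w := F.q i (f.lift w)
  differentiable_θ i := (F.differentiable_θ i).comp
    (differentiable_fst.prodMk (f.holo.comp differentiable_snd))
  differentiable_p i := (F.differentiable_p i).comp f.holo
  differentiable_q i := (F.differentiable_q i).comp f.holo
  θ_add i l z w := by
    have h : (idProd Λ f).per (latticePair l 0) = latticePair l 0 :=
      Subtype.ext (Prod.ext rfl (congrArg Subtype.val (map_zero f.per)))
    rw [F.θ_add, ← h]
    rfl
  dual i j w := F.dual i j _
  span w g hg z := by
    refine F.span (f.lift w) g ⟨hg.1, fun l z => ?_⟩ z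
    have h : (idProd Λ f).per (latticePair l 0) = latticePair l 0 :=
      Subtype.ext (Prod.ext rfl (congrArg Subtype.val (map_zero f.per)))
    rw [hg.2, ← h]
    rfl

theorem differentiable_θ_comp {E : Type*} [NormedAddCommGroup E] [NormedSpace ℂ E] (i : Fin r)
    {g : E → V} {h : E → W} (hg : Differentiable ℂ g) (hh : Differentiable ℂ h) :
    Differentiable ℂ fun e => F.θ i (g e) (h e) :=
  (F.differentiable_θ i).comp (hg.prodMk hh)

/-- The multiple of a relative frame by a nowhere vanishing function on the base. -/
def twist (g : W → ℂ) (hg : Differentiable ℂ g) (hg0 : ∀ w, g w ≠ 0) : 𝓛.RelFrame r where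
  θ i z w := F.θ i z w * g w
  p := F.p
  q i w := F.q i w * (g w)⁻¹
  differentiable_θ i := (F.differentiable_θ i).mul (hg.comp differentiable_snd)
  differentiable_p := F.differentiable_p
  differentiable_q i := (F.differentiable_q i).mul (hg.inv hg0)
  θ_add i l z w := by rw [F.θ_add, mul_assoc]
  dual i j w := by
    rw [← F.dual i j w]
    have := hg0 w
    field_simp
  span w f hf z := by
    rw [F.span w f hf z]
    refine Finset.sum_congr rfl fun i _ => ?_
    have := hg0 w
    field_simp

/-- The coordinates of functions on a slice with respect to a relative frame. -/
def functionCoord (w : W) : 𝓛.sliceFunctions w ≃ₗ[ℂ] (Fin r → ℂ) where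
  toFun f i := f.1 (F.p i w) * F.q i w
  map_add' f g := funext fun i => add_mul _ _ _
  map_smul' c f := funext fun i => mul_assoc _ _ _
  invFun c := ⟨fun z => ∑ i, c i * F.θ i z w, by
      have h : ∀ i, Differentiable ℂ fun z => F.θ i z w := fun i =>
        F.differentiable_θ_comp i differentiable_id (differentiable_const w)
      fun_prop,
    fun l z => by
      rw [Finset.mul_sum]
      exact Finset.sum_congr rfl fun i _ => by rw [F.θ_add, mul_left_comm]⟩
  left_inv f := Subtype.ext (funext fun z => (F.span w f.1 f.2 z).symm)
  right_inv c := funext fun j => by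
    change (∑ i, c i * F.θ i (F.p j w) w) * F.q j w = c j
    simp only [Finset.sum_mul, mul_assoc, F.dual, mul_ite, mul_one, mul_zero]
    simp

/-- The coordinates of sections over a slice with respect to a relative frame. -/
def coord {x : W ⧸ Λ'} (w : Over Λ' x) : 𝓛.sliceSections x ≃ₗ[ℂ] (Fin r → ℂ) :=
  (𝓛.sliceEquiv w).trans (F.functionCoord w.1)

theorem coord_apply {x : W ⧸ Λ'} (w : Over Λ' x) (t : 𝓛.sliceSections x) (i : Fin r) :
    F.coord w t i = t.1 (F.p i w.1) w * F.q i w.1 := rfl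

theorem eq_sum_coord {x : W ⧸ Λ'} (w : Over Λ' x) (t : 𝓛.sliceSections x) (z : V) :
    t.1 z w = ∑ i, F.coord w t i * F.θ i z w.1 :=
  F.span w.1 _ (𝓛.sliceEquiv w t).2 z

/-- The matrix by which coordinates change under translation by `n`. -/
def transition (n : Λ') (w : W) (j i : Fin r) : ℂ :=
  𝓛.e (latticePair 0 n) (F.p i (w + n), w) * F.θ j (F.p i (w + n)) w * F.q i (w + n)

theorem differentiable_transition (n : Λ') (j i : Fin r) :
    Differentiable ℂ fun w => F.transition n w j i := by
  have h1 : Differentiable ℂ fun w => F.p i (w + n) :=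
    (F.differentiable_p i).comp (differentiable_id.add_const _)
  have h2 : Differentiable ℂ fun w => F.q i (w + n) :=
    (F.differentiable_q i).comp (differentiable_id.add_const _)
  have h3 : Differentiable ℂ fun w => 𝓛.e (latticePair 0 n) (F.p i (w + n), w) :=
    (𝓛.holo _).comp (h1.prodMk differentiable_id)
  exact (h3.mul (F.differentiable_θ_comp j h1 differentiable_id)).mul h2

theorem coord_add {x : W ⧸ Λ'} (t : 𝓛.sliceSections x) (n : Λ') {w w' : Over Λ' x}
    (h : w'.1 = w.1 + n) (i : Fin r) :
    F.coord w' t i = ∑ j, F.coord w t j * F.transition n w.1 j i := by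
  rw [coord_apply, 𝓛.sliceSections_add t n _ h, F.eq_sum_coord w, h, Finset.mul_sum,
    Finset.sum_mul]
  exact Finset.sum_congr rfl fun j _ => by rw [transition]; ring

/-- Coordinates are values at the holomorphically moving points `p i w`, scaled by `q i w`. This is
why `RelFrame` carries `p` and `q`: holomorphy in `(z, w)` restricts to them with no further
argument. -/
theorem isHol_iff_coord (U : Set (W ⧸ Λ')) (s : ∀ x, 𝓛.sliceSections x) :
    𝓛.directImage.IsHol U s ↔
      ∀ i, DifferentiableOn ℂ (fun w : W => F.coord ⟨w, rfl⟩ (s w) i) (preim Λ' U) := by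
  constructor
  · intro h i
    have h1 : DifferentiableOn ℂ (fun w : W => (F.p i w, w)) (preim Λ' U) :=
      ((F.differentiable_p i).prodMk differentiable_id).differentiableOn
    exact (DifferentiableOn.comp h h1 fun w hw => ⟨Set.mem_univ _, hw⟩).mul
      (F.differentiable_q i).differentiableOn
  · intro h
    have h1 : ∀ i, DifferentiableOn ℂ (fun p : V × W => F.coord ⟨p.2, rfl⟩ (s p.2) i)
        (Set.univ ×ˢ preim Λ' U) := fun i =>
      (h i).comp differentiable_snd.differentiableOn fun p hp => hp.2
    have h2 : DifferentiableOn ℂ (fun p : V × W =>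
        ∑ i, F.coord ⟨p.2, rfl⟩ (s p.2) i * F.θ i p.1 p.2) (Set.univ ×ˢ preim Λ' U) :=
      DifferentiableOn.fun_sum fun i _ => (h1 i).mul (F.differentiable_θ i).differentiableOn
    exact h2.congr fun p _ => F.eq_sum_coord ⟨p.2, rfl⟩ (s p.2) p.1

end RelFrame

end LineBundle

/-- `σ` is a section of `W → W ⧸ Λ'` that is, on preimages of points of `U`, locally a
translation. -/
structure IsLocalSection (U : Set (W ⧸ Λ')) (σ : W ⧸ Λ' → W) : Prop where
  isOpen : IsOpen U
  coe_eq : ∀ y, (σ y : W ⧸ Λ') = y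
  eventually_eq : ∀ w ∈ preim Λ' U, ∃ n : Λ', ∀ᶠ w' : W in nhds w, σ (w' : W ⧸ Λ') = w' + n

/-- Two points of a ball of radius `ρ / 2` that are congruent modulo the lattice coincide.
Representatives are taken in the ball wherever possible and arbitrarily elsewhere. -/
theorem exists_isLocalSection {ρ : ℝ} (hρ : 0 < ρ) (hΛ' : ∀ n ∈ Λ', ‖n‖ < ρ → n = 0) (w₀ : W) :
    ∃ (U : Set (W ⧸ Λ')) (σ : W ⧸ Λ' → W), (w₀ : W ⧸ Λ') ∈ U ∧ IsLocalSection U σ := by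
  classical
  let B := Metric.ball w₀ (ρ / 2)
  have hex : ∀ y : W ⧸ Λ', ∃ w : W, (w : W ⧸ Λ') = y ∧
      ((∃ b ∈ B, (b : W ⧸ Λ') = y) → w ∈ B) := by
    intro y
    by_cases h : ∃ b ∈ B, (b : W ⧸ Λ') = y
    · obtain ⟨b, hb, hby⟩ := h
      exact ⟨b, hby, fun _ => hb⟩
    · obtain ⟨w, hw⟩ := QuotientAddGroup.mk_surjective y
      exact ⟨w, hw, fun h' => absurd h' h⟩
  choose σ hσ hσB using hex
  refine ⟨(fun w : W => (w : W ⧸ Λ')) '' B, σ, ⟨w₀, Metric.mem_ball_self (by positivity), rfl⟩,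
    QuotientAddGroup.isOpenMap_coe _ Metric.isOpen_ball, hσ, fun w hw => ?_⟩
  obtain ⟨b, hb, hbw⟩ := hw
  have hbw' : (w : W ⧸ Λ') = b := hbw.symm
  rw [QuotientAddGroup.eq] at hbw'
  refine ⟨⟨-w + b, hbw'⟩, ?_⟩
  have hc : ContinuousAt (fun w' : W => w' + (-w + b)) w := by fun_prop
  have hB : B ∈ nhds (w + (-w + b)) := by
    rw [add_neg_cancel_left]
    exact Metric.isOpen_ball.mem_nhds hb
  filter_upwards [hc hB] with w' hw'
  have h1 : ((w' + (-w + b) : W) : W ⧸ Λ') = w' := by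
    rw [eq_comm, QuotientAddGroup.eq, neg_add_cancel_left]
    exact hbw'
  have h2 := hσB (w' : W ⧸ Λ') ⟨_, hw', h1⟩
  have h3 : (σ (w' : W ⧸ Λ') : W ⧸ Λ') = (w' + (-w + b) : W) := (hσ _).trans h1.symm
  rw [QuotientAddGroup.eq] at h3
  have h4 := hΛ' _ h3 (by
    have d1 := Metric.mem_ball.1 h2
    have d2 : dist (w' + (-w + b)) w₀ < ρ / 2 := Metric.mem_ball.1 hw'
    rw [← sub_eq_neg_add, ← dist_eq_norm]
    linarith [dist_triangle_right (w' + (-w + b)) (σ (w' : W ⧸ Λ')) w₀])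
  exact neg_add_eq_zero.1 h4

namespace LineBundle.RelFrame

variable {𝓛 : LineBundle (Λ.prod Λ')} {r : ℕ} (F : 𝓛.RelFrame r)

/-- The frame of the direct image that comes from a relative frame and a section of
`W → W ⧸ Λ'`. -/
def localFrame {σ : W ⧸ Λ' → W} (hσ : ∀ y, (σ y : W ⧸ Λ') = y) (i : Fin r) (y : W ⧸ Λ') :
    𝓛.sliceSections y :=
  (F.coord ⟨σ y, hσ y⟩).symm (Pi.single i 1)

theorem eq_sum_localFrame {σ : W ⧸ Λ' → W} (hσ : ∀ y, (σ y : W ⧸ Λ') = y) (y : W ⧸ Λ')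
    (t : 𝓛.sliceSections y) :
    t = ∑ i, F.coord ⟨σ y, hσ y⟩ t i • F.localFrame hσ i y := by
  apply (F.coord ⟨σ y, hσ y⟩).injective
  ext j
  simp [localFrame, map_sum, Pi.single_apply]

/-- Locally `σ` is translation by a fixed lattice vector `n`, so in the coordinates at `w` the frame
is a row of the transition matrix for `-n` at `w + n`. -/
theorem isHol_localFrame {U : Set (W ⧸ Λ')} {σ : W ⧸ Λ' → W} (h : IsLocalSection U σ)
    (i : Fin r) : 𝓛.directImage.IsHol U (F.localFrame h.coe_eq i) := by
  rw [F.isHol_iff_coord]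
  intro j w hw
  obtain ⟨n, hn⟩ := h.eventually_eq w hw
  have h1 : DifferentiableAt ℂ (fun w' => F.transition (-n) (w' + n) i j) w :=
    ((F.differentiable_transition (-n) i j).comp
      (differentiable_id.add_const (n : W))).differentiableAt
  refine (h1.congr_of_eventuallyEq ?_).differentiableWithinAt
  filter_upwards [hn] with w' hw'
  rw [F.coord_add (w := ⟨σ w', h.coe_eq w'⟩) (w' := ⟨w', rfl⟩) _ (-n) (by
    change w' = σ (w' : W ⧸ Λ') + _
    rw [hw']; simp), Finset.sum_eq_single i]
  · simp [localFrame, hw']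
  · intro k _ hk
    simp [localFrame, Pi.single_eq_of_ne hk]
  · simp

/-- The coefficients in the local frame are the coordinates at `σ y`. They differ from the
coordinates at a nearby point of the cover by a transition matrix, which is holomorphic. -/
theorem isVectorBundle_directImage (F : 𝓛.RelFrame r) {ρ : ℝ} (hρ : 0 < ρ) (hΛ' : ∀ n ∈ Λ', ‖n‖ < ρ → n = 0) :
    𝓛.directImage.IsVectorBundle r := by
  constructor
  · intro U hU s
    refine ⟨fun h x hx => ⟨U, subset_rfl, hU, hx, h⟩, fun h p hp => ?_⟩
    obtain ⟨U', -, hU', hx, h'⟩ := h p.2 hp.2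
    exact (DifferentiableOn.differentiableAt h'
      ((isOpen_univ.prod (isOpen_preim hU')).mem_nhds ⟨Set.mem_univ _, hx⟩)).differentiableWithinAt
  · intro x
    obtain ⟨w₀, rfl⟩ := QuotientAddGroup.mk_surjective x
    obtain ⟨U, σ, hw₀, hσ⟩ := exists_isLocalSection hρ hΛ' w₀
    refine ⟨U, hσ.isOpen, hw₀, F.localFrame hσ.coe_eq, fun y _ => ?_, fun U' hU' hU'o s => ?_⟩
    · let b := Module.Basis.ofEquivFun (F.coord ⟨σ y, hσ.coe_eq y⟩)
      have hb : (fun i => F.localFrame hσ.coe_eq i y) = b := by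
        rw [Module.Basis.coe_ofEquivFun]
        rfl
      exact hb ▸ ⟨b.linearIndependent, b.span_eq⟩
    · constructor
      · intro hs
        refine ⟨fun i y => F.coord ⟨σ y, hσ.coe_eq y⟩ (s y) i, fun i w hw => ?_,
          fun y _ => F.eq_sum_localFrame hσ.coe_eq y (s y)⟩
        obtain ⟨n, hn⟩ := hσ.eventually_eq w (hU' hw)
        replace hs := (F.isHol_iff_coord U' s).1 hs
        have h1 : DifferentiableAt ℂ (fun w' : W => ∑ j, F.coord ⟨w', rfl⟩ (s w') j *
            F.transition n w' j i) w :=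
          DifferentiableAt.fun_sum fun j _ => ((hs j).differentiableAt
            ((isOpen_preim hU'o).mem_nhds hw)).mul (F.differentiable_transition n j i w)
        refine (h1.congr_of_eventuallyEq ?_).differentiableWithinAt
        filter_upwards [hn] with w' hw'
        exact F.coord_add (w := ⟨w', rfl⟩) (w' := ⟨σ w', hσ.coe_eq w'⟩) (s w') n hw' i
      · rintro ⟨c, hc, hs⟩
        refine (F.isHol_iff_coord U' s).2 fun i => ?_
        have h1 : ∀ j, DifferentiableOn ℂ (fun w : W =>
            F.coord ⟨w, rfl⟩ (F.localFrame hσ.coe_eq j w) i) (preim Λ' U') := fun j =>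
          ((F.isHol_iff_coord U _).1 (F.isHol_localFrame hσ j) i).mono fun w hw => hU' hw
        have h2 : DifferentiableOn ℂ (fun w : W => ∑ j, c j w *
            F.coord ⟨w, rfl⟩ (F.localFrame hσ.coe_eq j w) i) (preim Λ' U') :=
          DifferentiableOn.fun_sum fun j _ => (hc j).mul (h1 j)
        refine h2.congr fun w hw => ?_
        have h3 : s w = ∑ j, c j w • F.localFrame hσ.coe_eq j w := hs w hw
        rw [h3]
        simp

/-- Base change for the direct image. -/
theorem exists_baseChange_iso (F : 𝓛.RelFrame r) {ρ : ℝ} (hρ : 0 < ρ) (hΛ' : ∀ n ∈ Λ', ‖n‖ < ρ → n = 0)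
    (f : TorusMap Λ'' Λ') :
    ∃ Φ : (𝓛.directImage.pullback f).Iso (𝓛.pullback (idProd Λ f)).directImage,
      ∀ (x : X ⧸ Λ'') (t : 𝓛.sliceSections (f.map x)) (z : V) (w : Over Λ'' x)
        (w' : Over Λ' (f.map x)), w'.1 = f.lift w.1 →
        (show (𝓛.pullback (idProd Λ f)).sliceSections x from Φ.equiv x t).1 z w = t.1 z w' := by
  let lift : ∀ {x : X ⧸ Λ''}, Over Λ'' x → Over Λ' (f.map x) := fun {x} w =>
    ⟨f.lift w.1, congrArg f.map w.2⟩
  let m : ∀ x : X ⧸ Λ'', 𝓛.sliceSections (f.map x) →ₗ[ℂ]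
      (𝓛.pullback (idProd Λ f)).sliceSections x := fun x =>
    { toFun := fun t => ⟨fun z w => t.1 z (lift w), fun w => t.2.1 _, fun l z w w' h =>
        t.2.2 ((idProd Λ f).per l) z (lift w) (lift w') (by
          change f.lift w'.1 = f.lift w.1 + _
          rw [h]
          exact f.equivariant ⟨l.1.2, (AddSubgroup.mem_prod.1 l.2).2⟩ w.1)⟩
      map_add' := fun _ _ => rfl
      map_smul' := fun _ _ => rfl }
  -- In the coordinates of the frame and of its pullback the canonical map is the identity, whence
  -- bijectivity.
  have hm : ∀ x (w : Over Λ'' x) t, (F.pullback f).coord w (m x t) = F.coord (lift w) t :=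
    fun _ _ _ => rfl
  have hbij : ∀ x, Function.Bijective (m x) := by
    intro x
    obtain ⟨w, hw⟩ := QuotientAddGroup.mk_surjective x
    have h : ((F.pullback f).coord ⟨w, hw⟩) ∘ (m x) = F.coord (lift ⟨w, hw⟩) :=
      funext fun t => hm x ⟨w, hw⟩ t
    exact (Function.Bijective.of_comp_iff' ((F.pullback f).coord ⟨w, hw⟩).bijective _).1
      (h ▸ (F.coord (lift ⟨w, hw⟩)).bijective)
  refine ⟨⟨fun x => LinearEquiv.ofBijective (m x) (hbij x), fun U hU s => ?_⟩, ?_⟩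
  · constructor
    · intro h p hp
      obtain ⟨U', -, hU', hx, U'', -, hfU, n, t, c, ht, hc, hs⟩ := h p.2 hp.2
      have hg : Differentiable ℂ fun p : V × X => (p.1, f.lift p.2) :=
        differentiable_fst.prodMk (f.holo.comp differentiable_snd)
      have h1 : ∀ i, DifferentiableOn ℂ (fun p : V × X =>
          (t i (f.lift p.2 : W ⧸ Λ')).1 p.1 ⟨f.lift p.2, rfl⟩) (Set.univ ×ˢ preim Λ'' U') :=
        fun i => DifferentiableOn.comp (ht i) hg.differentiableOn
          fun p hp => ⟨Set.mem_univ _, hfU _ hp.2⟩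
      have h2 : ∀ i, DifferentiableOn ℂ (fun p : V × X => c i (p.2 : X ⧸ Λ''))
          (Set.univ ×ˢ preim Λ'' U') := fun i =>
        DifferentiableOn.comp (g := fun w : X => c i (w : X ⧸ Λ'')) (t := preim Λ'' U') (hc i)
          differentiable_snd.differentiableOn fun p hp => hp.2
      have h3 : DifferentiableOn ℂ (fun p : V × X => ∑ i, c i (p.2 : X ⧸ Λ'') *
          (t i (f.lift p.2 : W ⧸ Λ')).1 p.1 ⟨f.lift p.2, rfl⟩) (Set.univ ×ˢ preim Λ'' U') :=
        DifferentiableOn.fun_sum fun i _ => (h2 i).mul (h1 i)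
      refine ((h3.congr fun p hp => ?_).differentiableAt
        ((isOpen_univ.prod (isOpen_preim hU')).mem_nhds
          ⟨Set.mem_univ _, hx⟩)).differentiableWithinAt
      let t' : Fin n → 𝓛.sliceSections (f.lift p.2 : W ⧸ Λ') := fun i => t i _
      have h4 : s (p.2 : X ⧸ Λ'') = ∑ i, c i (p.2 : X ⧸ Λ'') • t' i := hs p.2 hp.2
      have h5 := congrArg (fun t : 𝓛.sliceSections (f.lift p.2 : W ⧸ Λ') =>
        t.1 p.1 ⟨f.lift p.2, rfl⟩) h4
      refine h5.trans ?_
      simp only [AddSubmonoidClass.coe_finsetSum, Finset.sum_apply]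
      rfl
    -- Conversely, a section is expanded in the pullback of the local frame near `f.lift w₀`, with
    -- its coordinates as holomorphic coefficients.
    · intro h x hx
      obtain ⟨w₀, rfl⟩ := QuotientAddGroup.mk_surjective x
      obtain ⟨U'', σ, hw₀, hσ⟩ := exists_isLocalSection hρ hΛ' (f.lift w₀)
      have hU' : IsOpen (U ∩ f.map ⁻¹' U'') :=
        hU.inter (hσ.isOpen.preimage (continuous_torusMap f))
      refine ⟨U ∩ f.map ⁻¹' U'', Set.inter_subset_left, hU', ⟨hx, hw₀⟩, U'', hσ.isOpen,
        fun y hy => hy.2, r, F.localFrame hσ.coe_eq,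
        fun i y => F.coord ⟨σ (f.map y), hσ.coe_eq _⟩ (s y) i,
        fun i => F.isHol_localFrame hσ i, fun i w hw => ?_,
        fun y _ => F.eq_sum_localFrame hσ.coe_eq (f.map y) (s y)⟩
      obtain ⟨n, hn⟩ := hσ.eventually_eq (f.lift w) hw.2
      have hs := ((F.pullback f).isHol_iff_coord U _).1 h
      have h1 : DifferentiableAt ℂ (fun w' : X =>
          ∑ j, F.coord (lift ⟨w', rfl⟩) (s w') j * F.transition n (f.lift w') j i) w :=
        DifferentiableAt.fun_sum fun j _ => DifferentiableAt.mul ((hs j).differentiableAt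
          ((isOpen_preim hU).mem_nhds hw.1))
          (((F.differentiable_transition n j i).comp f.holo) w)
      refine (h1.congr_of_eventuallyEq ?_).differentiableWithinAt
      filter_upwards [f.holo.continuous.continuousAt hn] with w' hw'
      have hw'' : σ (f.map w') = f.lift w' + n := hw'
      exact F.coord_add (w := lift ⟨w', rfl⟩) (w' := ⟨σ (f.map w'), hσ.coe_eq _⟩) (s w') n hw'' i
  · intro x t z w w' h
    have h' : w' = lift w := Subtype.ext h
    rw [h']
    rfl

/-- If the relative frame has the multipliers of `𝓛 ⊗ N^*` then the direct image is a direct sum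
of copies of `N`. -/
theorem nonempty_iso_directSum (N : LineBundle Λ')
    (hN : ∀ i (n : Λ') z w,
      N.e n w * F.θ i z (w + n) = 𝓛.e (latticePair 0 n) (z, w) * F.θ i z w) :
    Nonempty (𝓛.directImage.Iso (PreBundle.directSum fun _ : Fin r => N.toPreBundle)) := by
  -- By `hN` and duality the transition matrix is diagonal with all diagonal entries `N.e n w`, so
  -- each coordinate is by itself a section of `N`.
  have hcoord : ∀ (x : W ⧸ Λ') (t : 𝓛.sliceSections x) (i : Fin r) (n : Λ') (w w' : Over Λ' x),
      w'.1 = w.1 + n → F.coord w' t i = N.e n w.1 * F.coord w t i := by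
    intro x t i n w w' h
    rw [F.coord_add t n h, Finset.sum_eq_single i]
    · have h1 := F.dual i i (w.1 + n)
      rw [if_pos rfl] at h1
      rw [transition, ← hN]
      linear_combination F.coord w t i * N.e n w.1 * h1
    · intro j _ hji
      have h1 := F.dual j i (w.1 + n)
      rw [if_neg hji] at h1
      rw [transition, ← hN]
      linear_combination F.coord w t j * N.e n w.1 * h1
    · simp
  let m : ∀ x : W ⧸ Λ', 𝓛.sliceSections x →ₗ[ℂ] (Fin r → N.fiber x) := fun x =>
    { toFun := fun t i => ⟨fun w => F.coord w t i, fun l w w' h => hcoord x t i l w w' h⟩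
      map_add' := fun t t' => funext fun i => Subtype.ext (funext fun w => by simp)
      map_smul' := fun c t => funext fun i => Subtype.ext (funext fun w => by simp) }
  have hbij : ∀ x, Function.Bijective (m x) := by
    intro x
    obtain ⟨w, hw⟩ := QuotientAddGroup.mk_surjective x
    constructor
    · intro t t' h
      apply (F.coord ⟨w, hw⟩).injective
      ext i
      exact congrFun (congrArg Subtype.val (congrFun h i)) ⟨w, hw⟩
    · intro v
      refine ⟨(F.coord ⟨w, hw⟩).symm fun i => (v i).1 ⟨w, hw⟩, funext fun i =>
        Subtype.ext (funext fun w' => ?_)⟩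
      have hd : w'.1 = w + (⟨w'.1 - w, over_sub_mem ⟨w, hw⟩ w'⟩ : Λ') := by simp
      rw [(v i).2 _ ⟨w, hw⟩ w' hd]
      change F.coord w' _ i = _
      rw [hcoord x _ i _ ⟨w, hw⟩ w' hd, LinearEquiv.apply_symm_apply]
  exact ⟨⟨fun x => LinearEquiv.ofBijective (m x) (hbij x), fun U _ s => F.isHol_iff_coord U s⟩⟩

end LineBundle.RelFrame

end Relative

/-! ### The lattice and its dual. -/

theorem norm_add_conj_le (σ l : ℂ) : ‖σ * conj l + conj σ * l‖ ≤ 2 * ‖σ‖ * ‖l‖ := by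
  refine (norm_add_le _ _).trans (le_of_eq ?_)
  rw [norm_mul, norm_mul, Complex.norm_conj, Complex.norm_conj]
  ring

/-- The first generator of the lattice. -/
def lattice₁ (l₁ l₂ : ℂ) : lattice l₁ l₂ := ⟨l₁, AddSubgroup.subset_closure (Set.mem_insert _ _)⟩

/-- The second generator of the lattice. -/
def lattice₂ (l₁ l₂ : ℂ) : lattice l₁ l₂ :=
  ⟨l₂, AddSubgroup.subset_closure (Set.mem_insert_of_mem _ rfl)⟩

theorem lattice_induction {l₁ l₂ : ℂ} {P : lattice l₁ l₂ → Prop} (h₁ : P (lattice₁ l₁ l₂))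
    (h₂ : P (lattice₂ l₁ l₂)) (h0 : P 0) (hadd : ∀ l m, P l → P m → P (l + m))
    (hneg : ∀ l, P l → P (-l)) (l : lattice l₁ l₂) : P l := by
  obtain ⟨l, hl⟩ := l
  induction hl using AddSubgroup.closure_induction with
  | mem x hx =>
    rcases hx with rfl | hx
    · exact h₁
    · obtain rfl : x = l₂ := hx
      exact h₂
  | zero => exact h0
  | add x y hx hy hx' hy' => exact hadd ⟨x, hx⟩ ⟨y, hy⟩ hx' hy'
  | neg x hx hx' => exact hneg ⟨x, hx⟩ hx'

section Lattice

variable {l₁ l₂ : ℂ} (hl : 0 < (l₂ / l₁).im)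
include hl

/-- Up to the factor `2i` this is the area of a period parallelogram. -/
theorem conj_mul_sub_ne_zero : conj l₁ * l₂ - l₁ * conj l₂ ≠ 0 := by
  have hl₁ := period_ne_zero hl
  have h : conj l₁ * l₂ - l₁ * conj l₂ = conj l₁ * l₁ * (l₂ / l₁ - conj (l₂ / l₁)) := by
    have : conj l₁ ≠ 0 := (map_ne_zero _).2 hl₁
    rw [map_div₀]
    field_simp
  rw [h, Complex.sub_conj]
  refine mul_ne_zero (mul_ne_zero ((map_ne_zero _).2 hl₁) hl₁) (mul_ne_zero ?_ Complex.I_ne_zero)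
  exact_mod_cast (mul_pos two_pos hl).ne'

/-- For small `σ` the integers that `σ` pairs with the two generators have absolute value below `1`,
so they vanish; the resulting linear system is nonsingular. -/
theorem dualLattice_discrete :
    ∃ ρ > 0, ∀ σ ∈ dualLattice (lattice l₁ l₂), ‖σ‖ < ρ → σ = 0 := by
  have hl₁ := norm_pos_iff.2 (period_ne_zero hl)
  refine ⟨1 / (2 * (‖l₁‖ + ‖l₂‖)), by positivity, fun σ hσ hn => ?_⟩
  have key : ∀ l ∈ lattice l₁ l₂, ‖l‖ ≤ ‖l₁‖ + ‖l₂‖ → σ * conj l + conj σ * l = 0 := by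
    intro l hl hle
    obtain ⟨n, hn'⟩ := hσ l hl
    have h1 := norm_add_conj_le σ l
    rw [lt_div_iff₀ (by positivity)] at hn
    rw [hn'] at h1 ⊢
    rw [Complex.norm_intCast] at h1
    have h2 : |(n : ℝ)| < 1 := by
      refine h1.trans_lt (lt_of_le_of_lt ?_ hn)
      nlinarith [norm_nonneg σ]
    have h3 : |n| < 1 := by exact_mod_cast h2
    rw [Int.abs_lt_one_iff.1 h3, Int.cast_zero]
  have h1 := key _ (lattice₁ l₁ l₂).2 (le_add_of_nonneg_right (norm_nonneg _))
  have h2 := key _ (lattice₂ l₁ l₂).2 (le_add_of_nonneg_left (norm_nonneg _))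
  simp only [lattice₁, lattice₂] at h1 h2
  have h3 : σ * (conj l₁ * l₂ - l₁ * conj l₂) = 0 := by linear_combination l₂ * h1 - l₁ * h2
  exact (mul_eq_zero.1 h3).resolve_right (conj_mul_sub_ne_zero hl)

/-- The line bundle with multipliers `exp(2πi σ l̄)` is trivial exactly for `σ` in the dual
lattice. -/
theorem mem_dualLattice_iff (s : ℂ) : s ∈ dualLattice (lattice l₁ l₂) ↔
    ∃ h : ℂ → ℂ, Differentiable ℂ h ∧ (∀ v, h v ≠ 0) ∧
      ∀ (l : lattice l₁ l₂) v, expTwoPiI (s * conj (l : ℂ)) * h v = h (v + l) := by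
  constructor
  · intro hs
    refine ⟨fun z => expTwoPiI (-(conj s * z)), by fun_prop, fun _ => expTwoPiI_ne_zero _,
      fun l v => ?_⟩
    obtain ⟨n, hn⟩ := hs l l.2
    have h : s * conj (l : ℂ) + -(conj s * v) = n + -(conj s * (v + l)) := by
      linear_combination hn
    rw [← expTwoPiI_add, h, expTwoPiI_add, expTwoPiI_int, one_mul]
  · rintro ⟨h, hd, h0, hh⟩
    obtain ⟨k, hk⟩ := eq_exp_of_multiplicative hl hd h0
      (fun z => (hh (lattice₁ l₁ l₂) z).symm) (fun z => (hh (lattice₂ l₁ l₂) z).symm)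
    have key : ∀ l : lattice l₁ l₂, ∃ n : ℤ, s * conj (l : ℂ) - k * l = n := by
      intro l
      rw [← expTwoPiI_eq_one_iff, expTwoPiI_sub, div_eq_one_iff_eq (expTwoPiI_ne_zero _)]
      have h1 := hh l 0
      rw [zero_add, hk l, mul_comm] at h1
      exact mul_left_cancel₀ (h0 0) h1
    -- The numbers `s l̄ - k l` are integers, hence real. Comparison with their conjugates at two
    -- independent periods forces `k = -s̄`, and integrality becomes membership in the dual lattice.
    have hconj : ∀ l : lattice l₁ l₂, (s + conj k) * conj (l : ℂ) = conj (s + conj k) * l := by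
      intro l
      obtain ⟨n, hn⟩ := key l
      have h1 := congrArg conj hn
      simp only [map_sub, map_mul, Complex.conj_conj, map_intCast] at h1
      simp only [map_add, Complex.conj_conj]
      linear_combination hn - h1
    have h1 := hconj (lattice₁ l₁ l₂)
    have h2 := hconj (lattice₂ l₁ l₂)
    simp only [lattice₁, lattice₂] at h1 h2
    have h3 : (s + conj k) * (conj l₁ * l₂ - l₁ * conj l₂) = 0 := by
      linear_combination l₂ * h1 - l₁ * h2
    have h4 := (mul_eq_zero.1 h3).resolve_right (conj_mul_sub_ne_zero hl)
    have h5 : conj s = -k := by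
      have := congrArg conj h4
      simp only [map_add, Complex.conj_conj, map_zero] at this
      exact eq_neg_of_add_eq_zero_left this
    intro l hl'
    obtain ⟨n, hn⟩ := key ⟨l, hl'⟩
    exact ⟨n, by rw [h5, ← hn]; ring⟩

end Lattice

/-! ### Normal form of the multipliers and the map `φ`. -/

/-- A normal form of the multipliers of a line bundle of degree `δ`: after multiplication with the
coboundary of `h` they are `C l * exp(2πi a z l̄)`. -/
structure NormalForm {l₁ l₂ : ℂ} (L₀ : LineBundle (lattice l₁ l₂)) (δ : ℕ) where
  a : ℂ
  a_eq : a = δ / (conj l₁ * l₂ - l₁ * conj l₂)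
  h : ℂ → ℂ
  C : lattice l₁ l₂ → ℂ
  differentiable_h : Differentiable ℂ h
  h_ne_zero : ∀ z, h z ≠ 0
  C_ne_zero : ∀ l, C l ≠ 0
  e_mul : ∀ (l : lattice l₁ l₂) z,
    L₀.e l z * h z = C l * expTwoPiI (a * z * conj (l : ℂ)) * h (z + l)

theorem nonempty_normalForm {l₁ l₂ : ℂ} (hl : 0 < (l₂ / l₁).im) {L₀ : LineBundle (lattice l₁ l₂)}
    {δ : ℕ} (hL₀ : HasDegree L₀ δ) : Nonempty (NormalForm L₀ δ) := by
  obtain ⟨f₁, f₂, hf₁, hf₂, he₁, he₂, hdeg⟩ := hL₀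
  have harea := conj_mul_sub_ne_zero hl
  -- With this `a`, the functions `a z l̄` at the two generators also have degree `δ`, so
  -- subtracting them from `f₁`, `f₂` leaves an additive cocycle.
  set a : ℂ := δ / (conj l₁ * l₂ - l₁ * conj l₂) with ha
  have ha' : a * (conj l₁ * l₂ - l₁ * conj l₂) = δ := div_mul_cancel₀ _ harea
  obtain ⟨k, c, hk, hk₁, hk₂⟩ := exists_primitive_of_cocycle hl
    (g₁ := fun z => f₁ z - a * z * conj l₁) (g₂ := fun z => f₂ z - a * z * conj l₂)
    (by fun_prop) (by fun_prop) (fun z => by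
      have := hdeg z
      push_cast at this
      linear_combination this - ha')
  have hex : ∀ l : lattice l₁ l₂, ∃ C : ℂ, C ≠ 0 ∧ ∀ z, L₀.e l z * expTwoPiI (k z) =
      C * expTwoPiI (a * z * conj (l : ℂ)) * expTwoPiI (k (z + l)) := by
    intro l
    induction l using lattice_induction with
    | h₁ =>
      refine ⟨1, one_ne_zero, fun z => ?_⟩
      rw [one_mul, ← expTwoPiI_add, lattice₁, he₁]
      change expTwoPiI (f₁ z) * _ = _
      rw [← expTwoPiI_add]
      congr 1
      linear_combination -hk₁ z
    | h₂ =>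
      refine ⟨expTwoPiI c, expTwoPiI_ne_zero _, fun z => ?_⟩
      rw [← expTwoPiI_add, ← expTwoPiI_add, lattice₂, he₂]
      change expTwoPiI (f₂ z) * _ = _
      rw [← expTwoPiI_add]
      congr 1
      linear_combination -hk₂ z
    | h0 => exact ⟨1, one_ne_zero, fun z => by simp [L₀.e_zero, expTwoPiI_zero]⟩
    | hadd l m hl hm =>
      obtain ⟨C, hC, h⟩ := hl
      obtain ⟨D, hD, h'⟩ := hm
      -- The extra factor comes from replacing `z` by `z + m` in the exponent for `l`; thus `C` need
      -- not be a character.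
      refine ⟨C * D * expTwoPiI (a * m * conj (l : ℂ)), mul_ne_zero (mul_ne_zero hC hD)
        (expTwoPiI_ne_zero _), fun z => ?_⟩
      have e1 := h (z + m)
      have e2 : expTwoPiI (a * z * conj ((l + m : lattice l₁ l₂) : ℂ)) *
          expTwoPiI (a * m * conj (l : ℂ)) = expTwoPiI (a * z * conj (m : ℂ)) *
          expTwoPiI (a * (z + m) * conj (l : ℂ)) := by
        rw [← expTwoPiI_add, ← expTwoPiI_add, AddSubgroup.coe_add, map_add]
        congr 1
        ring
      rw [show z + ((l + m : lattice l₁ l₂) : ℂ) = z + m + l by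
        rw [AddSubgroup.coe_add]; ring, L₀.cocycle]
      linear_combination L₀.e l (z + m) * h' z + D * expTwoPiI (a * z * conj (m : ℂ)) * e1 -
        C * D * expTwoPiI (k (z + m + l)) * e2
    | hneg l hl =>
      obtain ⟨C, hC, h⟩ := hl
      refine ⟨C⁻¹ * expTwoPiI (a * l * conj (l : ℂ)), mul_ne_zero (inv_ne_zero hC)
        (expTwoPiI_ne_zero _), fun z => ?_⟩
      have e1 := h (z + (-l : lattice l₁ l₂))
      have e2 := L₀.cocycle l (-l) z
      rw [add_neg_cancel, L₀.e_zero] at e2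
      have e3 : z + ((-l : lattice l₁ l₂) : ℂ) + l = z := by simp
      rw [e3] at e1
      have e4 : expTwoPiI (a * (z + (-l : lattice l₁ l₂)) * conj (l : ℂ)) *
          (expTwoPiI (a * l * conj (l : ℂ)) *
            expTwoPiI (a * z * conj ((-l : lattice l₁ l₂) : ℂ))) = 1 := by
        rw [← expTwoPiI_add, ← expTwoPiI_add, ← expTwoPiI_zero]
        congr 1
        simp only [AddSubgroup.coe_neg, map_neg]
        ring
      have hC' : C * C⁻¹ = 1 := mul_inv_cancel₀ hC
      have hne := L₀.ne_zero l (z + (-l : lattice l₁ l₂))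
      apply mul_left_cancel₀ hne
      linear_combination -expTwoPiI (k z) * e2 - C⁻¹ * (expTwoPiI (a * l * conj (l : ℂ)) *
        expTwoPiI (a * z * conj ((-l : lattice l₁ l₂) : ℂ))) * e1 -
        expTwoPiI (k z) * e4 - expTwoPiI (k z) *
        (expTwoPiI (a * (z + (-l : lattice l₁ l₂)) * conj (l : ℂ)) *
          (expTwoPiI (a * l * conj (l : ℂ)) *
            expTwoPiI (a * z * conj ((-l : lattice l₁ l₂) : ℂ)))) * hC'
  choose C hC h using hex
  exact ⟨⟨a, ha, fun z => expTwoPiI (k z), C, by fun_prop, fun _ => expTwoPiI_ne_zero _, hC, h⟩⟩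

namespace NormalForm

variable {l₁ l₂ : ℂ} (hl : 0 < (l₂ / l₁).im) {δ : ℕ} (hδ : 0 < δ)
  {L₀ : LineBundle (lattice l₁ l₂)} (N : NormalForm L₀ δ)

theorem C_zero : N.C 0 = 1 := by
  have h := N.e_mul 0 0
  simp only [L₀.e_zero, mul_zero, zero_mul, expTwoPiI_zero, mul_one, AddSubgroup.coe_zero,
    add_zero, one_mul] at h
  exact ((mul_eq_right₀ (N.h_ne_zero 0)).1 h.symm)

theorem C_add (l m : lattice l₁ l₂) :
    N.C (l + m) = N.C l * N.C m * expTwoPiI (N.a * m * conj (l : ℂ)) := by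
  have h1 := N.e_mul (l + m) 0
  have h2 := N.e_mul m 0
  have h3 := N.e_mul l m
  simp only [mul_zero, zero_mul, expTwoPiI_zero, mul_one, zero_add] at h1 h2
  rw [L₀.cocycle, zero_add, AddSubgroup.coe_add, add_comm (l : ℂ)] at h1
  have h4 := N.h_ne_zero (m + l)
  apply mul_right_cancel₀ h4
  linear_combination -h1 + L₀.e l m * h2 + N.C m * h3

theorem conj_a : conj N.a = -N.a := by
  rw [N.a_eq, map_div₀, map_sub, map_mul, map_mul, Complex.conj_conj, Complex.conj_conj,
    Complex.conj_natCast, ← div_neg]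
  congr 1
  ring

/-- `C (l + m)` is symmetric in `l` and `m`, so `a l m̄ - a m l̄` is an integer; as `a` is purely
imaginary, this is the pairing of `a l` with `m`. -/
theorem a_mul_mem (l : lattice l₁ l₂) : N.a * l ∈ dualLattice (lattice l₁ l₂) := by
  intro m hm
  have h1 := N.C_add ⟨m, hm⟩ l
  rw [add_comm, N.C_add l ⟨m, hm⟩] at h1
  have h2 : expTwoPiI (N.a * l * conj m - N.a * m * conj (l : ℂ)) = 1 := by
    rw [expTwoPiI_sub, div_eq_one_iff_eq (expTwoPiI_ne_zero _)]
    apply mul_left_cancel₀ (mul_ne_zero (N.C_ne_zero l) (N.C_ne_zero ⟨m, hm⟩))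
    rw [h1]
    ring
  obtain ⟨n, hn⟩ := expTwoPiI_eq_one_iff.1 h2
  refine ⟨n, ?_⟩
  rw [map_mul, N.conj_a, ← hn]
  ring

include hl hδ in
theorem a_ne_zero : N.a ≠ 0 := by
  rw [N.a_eq]
  exact div_ne_zero (by exact_mod_cast hδ.ne') (conj_mul_sub_ne_zero hl)

include hl hδ N in
theorem lattice_discrete : ∃ ρ > 0, ∀ l ∈ lattice l₁ l₂, ‖l‖ < ρ → l = 0 := by
  obtain ⟨ρ, hρ, h⟩ := dualLattice_discrete hl
  have ha := N.a_ne_zero hl hδ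
  refine ⟨ρ / ‖N.a‖, div_pos hρ (norm_pos_iff.2 ha), fun l hl' hn => ?_⟩
  rw [lt_div_iff₀ (norm_pos_iff.2 ha), mul_comm, ← norm_mul] at hn
  exact (mul_eq_zero.1 (h _ (N.a_mul_mem ⟨l, hl'⟩) hn)).resolve_left ha

/-- The map `φ_{L₀}` in the coordinates of a normal form. -/
def phi : TorusMap (lattice l₁ l₂) (dualLattice (lattice l₁ l₂)) where
  lift v := N.a * v
  holo := by fun_prop
  per :=
    { toFun := fun l => ⟨N.a * l, N.a_mul_mem l⟩
      map_zero' := Subtype.ext (mul_zero _)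
      map_add' := fun _ _ => Subtype.ext (mul_add _ _ _) }
  equivariant _ _ := mul_add _ _ _

theorem poincare_slice_e {Λ : AddSubgroup ℂ} (σ : ℂ) (l : Λ) (v : ℂ) :
    ((poincare Λ).pullback (slice Λ (dualLattice Λ) σ)).e l v = expTwoPiI (σ * conj (l : ℂ)) := by
  change Complex.exp (2 * Real.pi * Complex.I * ((σ + 0) * conj (l : ℂ) - conj (0 : ℂ) * v)) = _
  rw [expTwoPiI, add_zero, map_zero, zero_mul, sub_zero]

include hl in
-- Modulo the coboundary of `h (v + μ) / h v` the bundle `L_μ ⊗ L₀^*` has the constant multipliers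
-- `exp(2πi a μ l̄)`. The question is thus when `exp(2πi (aμ - σ) l̄)` is trivial, which
-- `mem_dualLattice_iff` answers.
theorem isIso_iff (μ σ : ℂ) :
    ((poincare (lattice l₁ l₂)).pullback (slice _ _ σ)).IsIso
      ((translate L₀ μ).tensor L₀.dual) ↔
    (σ : ℂ ⧸ dualLattice (lattice l₁ l₂)) = (N.a * μ : ℂ) := by
  rw [QuotientAddGroup.eq, ← sub_eq_neg_add, mem_dualLattice_iff hl]
  have hT : ∀ l v, ((translate L₀ μ).tensor L₀.dual).e l v * (N.h (v + μ) / N.h v) =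
      expTwoPiI (N.a * μ * conj (l : ℂ)) * (N.h (v + l + μ) / N.h (v + l)) := by
    intro l v
    have h1 := N.e_mul l (v + μ)
    have h2 := N.e_mul l v
    have h3 := N.h_ne_zero v
    have h4 := N.h_ne_zero (v + l)
    have h5 := L₀.ne_zero l v
    change L₀.e l (v + μ) * (L₀.e l v)⁻¹ * _ = _
    rw [mul_add, add_mul, expTwoPiI_add, add_right_comm] at h1
    have h6 : L₀.e l v * N.h v ≠ 0 := mul_ne_zero h5 h3
    have hY := expTwoPiI_ne_zero (N.a * v * conj (l : ℂ))
    generalize expTwoPiI (N.a * v * conj (l : ℂ)) = Y at *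
    generalize expTwoPiI (N.a * μ * conj (l : ℂ)) = X at *
    field_simp
    linear_combination N.h (v + l) * h1 - X * N.h (v + l + μ) * h2
  have hH : Differentiable ℂ fun v => N.h (v + μ) / N.h v := by
    have := N.differentiable_h
    exact Differentiable.div (by fun_prop) this N.h_ne_zero
  have hH0 : ∀ v, N.h (v + μ) / N.h v ≠ 0 := fun v =>
    div_ne_zero (N.h_ne_zero _) (N.h_ne_zero _)
  have hexp : ∀ l : lattice l₁ l₂, expTwoPiI ((N.a * μ - σ) * conj (l : ℂ)) *
      expTwoPiI (σ * conj (l : ℂ)) = expTwoPiI (N.a * μ * conj (l : ℂ)) := by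
    intro l
    rw [← expTwoPiI_add]
    congr 1
    ring
  constructor
  · rintro ⟨g, hg, hg0, h⟩
    refine ⟨fun v => g v / (N.h (v + μ) / N.h v), hg.div hH hH0,
      fun v => div_ne_zero (hg0 v) (hH0 v), fun l v => ?_⟩
    have h1 := h l v
    rw [poincare_slice_e] at h1
    have h2 := hT l v
    have e1 := hH0 v
    have e2 := hH0 (v + l)
    have e3 := hexp l
    beta_reduce
    generalize N.h (v + μ) / N.h v = A at *
    generalize N.h (v + l + μ) / N.h (v + l) = B at *
    have e4 := expTwoPiI_ne_zero (σ * conj (l : ℂ))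
    rw [mul_div_assoc', div_eq_div_iff e1 e2]
    apply mul_right_cancel₀ e4
    linear_combination g v * B * e3 - g v * h2 + A * h1
  · rintro ⟨G, hG, hG0, h⟩
    refine ⟨fun v => G v * (N.h (v + μ) / N.h v), hG.mul hH,
      fun v => mul_ne_zero (hG0 v) (hH0 v), fun l v => ?_⟩
    beta_reduce
    rw [poincare_slice_e, ← h l v]
    linear_combination G v * hT l v - G v * (N.h (v + l + μ) / N.h (v + l)) * hexp l

include hl in
theorem isPhi_phi : IsPhi L₀ N.phi := fun μ σ => N.isIso_iff hl μ σ

include hl in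
-- The defining property determines only the map of quotients. The difference of two lifts is
-- continuous with values in a discrete group, hence constant.
theorem exists_lift_eq {φ : TorusMap (lattice l₁ l₂) (dualLattice (lattice l₁ l₂))}
    (hφ : IsPhi L₀ φ) :
    ∃ b ∈ dualLattice (lattice l₁ l₂), ∀ w, φ.lift w = N.a * w + b := by
  have hD : ∀ w, φ.lift w - N.a * w ∈ dualLattice (lattice l₁ l₂) := by
    intro w
    have h := (hφ w (N.a * w)).1 ((N.isIso_iff hl w _).2 rfl)
    rw [sub_eq_neg_add]
    exact QuotientAddGroup.eq.1 h
  obtain ⟨ρ, hρ, hdisc⟩ := dualLattice_discrete hl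
  have hcont : Continuous fun w => φ.lift w - N.a * w := by
    have := φ.holo.continuous
    fun_prop
  have hloc : IsLocallyConstant fun w => φ.lift w - N.a * w := by
    rw [IsLocallyConstant.iff_eventually_eq]
    intro w
    filter_upwards [hcont.continuousAt (Metric.ball_mem_nhds _ hρ)] with w' hw'
    exact sub_eq_zero.1 (hdisc _ (sub_mem (hD w') (hD w)) (mem_ball_iff_norm.1 hw'))
  refine ⟨φ.lift 0 - N.a * 0, hD 0, fun w => ?_⟩
  rw [← hloc.apply_eq_of_preconnectedSpace w 0]
  ring

theorem per_eq {φ : TorusMap (lattice l₁ l₂) (dualLattice (lattice l₁ l₂))} {b : ℂ}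
    (h : ∀ w, φ.lift w = N.a * w + b) (n : lattice l₁ l₂) : (φ.per n : ℂ) = N.a * n := by
  have := φ.equivariant n 0
  rw [h, h] at this
  linear_combination -this

/-! ### Theta functions in normal form and the resulting frames. -/

/-- The theta functions for the multipliers in normal form. -/
def IsTheta (ψ : ℂ → ℂ) : Prop :=
  Differentiable ℂ ψ ∧ ∀ (l : lattice l₁ l₂) z,
    ψ (z + l) = N.C l * expTwoPiI (N.a * z * conj (l : ℂ)) * ψ z

theorem isTheta_of_generators {ψ : ℂ → ℂ} (hψ : Differentiable ℂ ψ)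
    (h₁ : ∀ z, ψ (z + l₁) =
      N.C (lattice₁ l₁ l₂) * expTwoPiI (N.a * z * conj l₁) * ψ z)
    (h₂ : ∀ z, ψ (z + l₂) =
      N.C (lattice₂ l₁ l₂) * expTwoPiI (N.a * z * conj l₂) * ψ z) : N.IsTheta ψ := by
  refine ⟨hψ, fun l => ?_⟩
  induction l using lattice_induction with
  | h₁ => exact h₁
  | h₂ => exact h₂
  | h0 => intro z; simp [N.C_zero, expTwoPiI_zero]
  | hadd l m hl hm =>
    intro z
    have e : expTwoPiI (N.a * m * conj (l : ℂ)) *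
        expTwoPiI (N.a * z * conj ((l + m : lattice l₁ l₂) : ℂ)) =
        expTwoPiI (N.a * (z + m) * conj (l : ℂ)) * expTwoPiI (N.a * z * conj (m : ℂ)) := by
      rw [← expTwoPiI_add, ← expTwoPiI_add, AddSubgroup.coe_add, map_add]
      congr 1
      ring
    rw [show z + ((l + m : lattice l₁ l₂) : ℂ) = z + m + l by
      rw [AddSubgroup.coe_add]; ring, hl, hm, N.C_add]
    linear_combination -N.C l * N.C m * ψ z * e
  | hneg l hl =>
    intro z
    have e1 := hl (z + (-l : lattice l₁ l₂))
    rw [show z + ((-l : lattice l₁ l₂) : ℂ) + l = z by simp] at e1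
    have e2 := N.C_add l (-l)
    rw [add_neg_cancel, N.C_zero] at e2
    have e3 : expTwoPiI (N.a * z * conj ((-l : lattice l₁ l₂) : ℂ)) *
        expTwoPiI (N.a * (z + (-l : lattice l₁ l₂)) * conj (l : ℂ)) =
        expTwoPiI (N.a * (-l : lattice l₁ l₂) * conj (l : ℂ)) := by
      rw [← expTwoPiI_add]
      congr 1
      simp only [AddSubgroup.coe_neg, map_neg]
      ring
    rw [e1]
    linear_combination ψ (z + (-l : lattice l₁ l₂)) * e2 -
      N.C (-l) * N.C l * ψ (z + (-l : lattice l₁ l₂)) * e3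

include hl hδ in
theorem exists_isTheta_dual_to_points : ∃ (ψ : Fin δ → ℂ → ℂ) (u : Fin δ → ℂ),
    (∀ i, N.IsTheta (ψ i)) ∧ (∀ i j, ψ i (u j) = if i = j then 1 else 0) ∧
      ∀ f, N.IsTheta f → ∀ x, f x = ∑ i, f (u i) * ψ i x := by
  have hl₁ := period_ne_zero hl
  obtain ⟨c₁, hc₁⟩ := exists_expTwoPiI_eq (N.C_ne_zero (lattice₁ l₁ l₂))
  obtain ⟨c₂, hc₂⟩ := exists_expTwoPiI_eq (N.C_ne_zero (lattice₂ l₁ l₂))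
  have ha : N.a * (conj l₁ * l₂ - l₁ * conj l₂) = δ := by
    rw [N.a_eq, div_mul_cancel₀ _ (conj_mul_sub_ne_zero hl)]
  -- The quadratic `Q` is chosen so that multiplication by `expTwoPiI (Q z)` removes the multiplier
  -- of `l₁`; the multiplier of `l₂` then becomes that of `thetaSpace` with the parameter `c₂ + κτ²
  -- + βτ`.
  set κ : ℂ := -(N.a * l₁ * conj l₁) / 2 with hκ
  set β : ℂ := -κ - c₁ with hβ
  set Q : ℂ → ℂ := fun z => κ * z ^ 2 + β * z with hQ
  have hQd : Differentiable ℂ Q := by rw [hQ]; fun_prop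
  set τ := l₂ / l₁ with hτ
  have hτl : l₁ * τ = l₂ := mul_div_cancel₀ _ hl₁
  obtain ⟨Ψ, u, hΨ, hdual, hspan⟩ := exists_theta_dual_to_points hl hδ (c₂ + κ * τ ^ 2 + β * τ)
  have hdiv₁ : ∀ z, (z + l₁) / l₁ = z / l₁ + 1 := fun z => by field_simp
  have hdiv₂ : ∀ z, (z + l₂) / l₁ = z / l₁ + τ := fun z => by rw [hτ]; field_simp
  have hmul₁ : ∀ z, l₁ * (z + 1) = l₁ * z + l₁ := fun z => by ring
  have hmul₂ : ∀ z, l₁ * (z + τ) = l₁ * z + l₂ := fun z => by rw [mul_add, hτl]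
  have hQ₁ : ∀ z, Q (z + 1) = Q z - (c₁ + N.a * (l₁ * z) * conj l₁) := fun z => by
    simp only [hQ, hβ, hκ]; ring
  have hQ₂ : ∀ z, Q (z + τ) = Q z + (c₂ + κ * τ ^ 2 + β * τ - δ * z) -
      (c₂ + N.a * (l₁ * z) * conj l₂) := fun z => by
    simp only [hQ, hκ]
    linear_combination (-N.a * z * conj l₁) * hτl - z * ha
  -- The constant `Q (u i)` restores the value `1` at the point `l₁ * u i`.
  refine ⟨fun i z => Ψ i (z / l₁) * expTwoPiI (Q (u i) - Q (z / l₁)), fun i => l₁ * u i,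
    fun i => ?_, fun i j => ?_, fun f hf x => ?_⟩
  · have hd := (hΨ i).1
    refine N.isTheta_of_generators (by fun_prop) (fun z => ?_) (fun z => ?_)
    · beta_reduce
      rw [hdiv₁, (hΨ i).2.1, hQ₁, ← hc₁, mul_div_cancel₀ _ hl₁,
        show Q (u i) - (Q (z / l₁) - (c₁ + N.a * z * conj l₁)) =
          c₁ + N.a * z * conj l₁ + (Q (u i) - Q (z / l₁)) by ring, expTwoPiI_add, expTwoPiI_add]
      ring
    · beta_reduce
      rw [hdiv₂, (hΨ i).2.2, hQ₂, ← hc₂, mul_div_cancel₀ _ hl₁, mul_right_comm, ← expTwoPiI_add,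
        ← expTwoPiI_add, mul_left_comm, ← expTwoPiI_add, mul_comm]
      congr 2
      ring
  · simp only [mul_div_cancel_left₀ _ hl₁]
    rw [hdual]
    split_ifs with hij
    · rw [hij, sub_self, expTwoPiI_zero, mul_one]
    · rw [zero_mul]
  · have hf' : (fun z => f (l₁ * z) * expTwoPiI (Q z)) ∈
        thetaSpace τ δ (c₂ + κ * τ ^ 2 + β * τ) := by
      have hd := hf.1
      refine ⟨by fun_prop, fun z => ?_, fun z => ?_⟩
      · have := hf.2 (lattice₁ l₁ l₂) (l₁ * z)
        simp only [lattice₁] at this hc₁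
        beta_reduce
        rw [hmul₁, this, ← hc₁, hQ₁, ← expTwoPiI_add, expTwoPiI_sub]
        have := expTwoPiI_ne_zero (c₁ + N.a * (l₁ * z) * conj l₁)
        generalize expTwoPiI (c₁ + N.a * (l₁ * z) * conj l₁) = A at *
        field_simp
      · have := hf.2 (lattice₂ l₁ l₂) (l₁ * z)
        simp only [lattice₂] at this hc₂
        beta_reduce
        rw [hmul₂, this, ← hc₂, hQ₂, ← expTwoPiI_add, expTwoPiI_sub, expTwoPiI_add (Q z)]
        have := expTwoPiI_ne_zero (c₂ + N.a * (l₁ * z) * conj l₂)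
        generalize expTwoPiI (c₂ + N.a * (l₁ * z) * conj l₂) = A at *
        generalize expTwoPiI (c₂ + κ * τ ^ 2 + β * τ - δ * z) = B at *
        field_simp
    have h := hspan _ hf' (x / l₁)
    simp only [mul_div_cancel₀ x hl₁] at h
    apply mul_right_cancel₀ (expTwoPiI_ne_zero (Q (x / l₁)))
    rw [h, Finset.sum_mul]
    refine Finset.sum_congr rfl fun i _ => ?_
    beta_reduce
    rw [expTwoPiI_sub]
    have := expTwoPiI_ne_zero (Q (x / l₁))
    field_simp

theorem tildeE_e (L₀ : LineBundle (lattice l₁ l₂)) (l : lattice l₁ l₂) (z σ : ℂ) :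
    (tildeE L₀).e (latticePair l 0) (z, σ) = L₀.e l z * expTwoPiI (σ * conj (l : ℂ)) := by
  rw [← poincare_slice_e σ l z]
  rfl

include hl hδ in
/-- The sections `h(z) ψ_i(z + σ / a)` form a relative frame of `Ẽ`. -/
theorem exists_relFrame : ∃ (ψ : Fin δ → ℂ → ℂ) (F : (tildeE L₀).RelFrame δ),
    (∀ i, N.IsTheta (ψ i)) ∧ ∀ i z σ, F.θ i z σ = N.h z * ψ i (z + σ / N.a) := by
  obtain ⟨ψ, u, hψ, hdual, hspan⟩ := N.exists_isTheta_dual_to_points hl hδ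
  have ha := N.a_ne_zero hl hδ
  have hh := N.differentiable_h
  refine ⟨ψ, {
    θ := fun i z σ => N.h z * ψ i (z + σ / N.a)
    -- Since `a (σ / a) l̄ = σ l̄`, translation by `σ / a` produces exactly the multipliers of
    -- `P_σ`. The evaluation points move the opposite way, and `q` divides out `h`.
    p := fun i σ => u i - σ / N.a
    q := fun i σ => (N.h (u i - σ / N.a))⁻¹
    differentiable_θ := fun i => by
      have := (hψ i).1
      fun_prop
    differentiable_p := fun i => by fun_prop
    differentiable_q := fun i => Differentiable.inv (by fun_prop) fun σ => N.h_ne_zero _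
    θ_add := fun i l z σ => ?_
    dual := fun i j σ => ?_
    span := fun σ f hf z => ?_ }, hψ, fun _ _ _ => rfl⟩
  · have h1 := N.e_mul l z
    have h2 := (hψ i).2 l (z + σ / N.a)
    rw [tildeE_e, add_right_comm, h2]
    have h3 : N.a * (z + σ / N.a) * conj (l : ℂ) =
        N.a * z * conj (l : ℂ) + σ * conj (l : ℂ) := by field_simp
    rw [h3, expTwoPiI_add]
    linear_combination -expTwoPiI (σ * conj (l : ℂ)) * ψ i (z + σ / N.a) * h1
  · rw [sub_add_cancel, hdual, mul_right_comm, mul_inv_cancel₀ (N.h_ne_zero _), one_mul]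
  · have hθ : N.IsTheta fun x => f (x - σ / N.a) / N.h (x - σ / N.a) := by
      have hd := hf.1
      refine ⟨Differentiable.div (by fun_prop) (by fun_prop) fun _ => N.h_ne_zero _,
        fun l x => ?_⟩
      have h1 := N.e_mul l (x - σ / N.a)
      have h2 := hf.2 l (x - σ / N.a)
      rw [tildeE_e] at h2
      have h3 : N.a * x * conj (l : ℂ) =
        N.a * (x - σ / N.a) * conj (l : ℂ) + σ * conj (l : ℂ) := by field_simp; ring
      have h4 : x + l - σ / N.a = x - σ / N.a + l := by ring
      beta_reduce
      rw [h3, h4, expTwoPiI_add, h2]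
      clear h2 h3 h4
      generalize x - σ / N.a = y at *
      rw [mul_div_assoc', div_eq_div_iff (N.h_ne_zero _) (N.h_ne_zero _)]
      linear_combination expTwoPiI (σ * conj (l : ℂ)) * f y * h1
    have h := hspan _ hθ (z + σ / N.a)
    simp only [add_sub_cancel_right] at h
    have e1 := N.h_ne_zero z
    rw [div_eq_iff e1, Finset.sum_mul] at h
    rw [h]
    refine Finset.sum_congr rfl fun i _ => ?_
    ring

/-! ### The bundle `E'` and its splitting. -/

variable {φ : TorusMap (lattice l₁ l₂) (dualLattice (lattice l₁ l₂))}

/-- On the slice over `μ` the Poincaré factor is the bundle of the point `φ(μ)`, which represents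
`L_μ ⊗ L₀^*`; the factor `L₀` cancels. -/
theorem tildeE'_isIso_translate (hφ : IsPhi L₀ φ) (μ : ℂ) :
    ((tildeE' L₀ φ).pullback (slice _ _ μ)).IsIso (translate L₀ μ) := by
  obtain ⟨g, hg, hg0, h⟩ := (hφ μ (φ.lift μ)).2 rfl
  refine ⟨g, hg, hg0, fun l v => ?_⟩
  have h1 := h l v
  have h2 : ((tildeE' L₀ φ).pullback (slice _ _ μ)).e l v = L₀.e l v *
      ((poincare (lattice l₁ l₂)).pullback (slice _ _ (φ.lift μ))).e l v := by
    have h0 : (idProd (lattice l₁ l₂) φ).per (latticePair l 0) = latticePair l 0 :=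
      Subtype.ext (Prod.ext rfl (congrArg Subtype.val (map_zero φ.per)))
    change L₀.e l v * (poincare (lattice l₁ l₂)).e
      ((idProd (lattice l₁ l₂) φ).per (latticePair l 0)) (v, φ.lift μ) = _
    rw [h0]
    rfl
  have h3 : ((translate L₀ μ).tensor L₀.dual).e l v =
    (translate L₀ μ).e l v * (L₀.e l v)⁻¹ := rfl
  rw [h3] at h1
  rw [h2]
  have h4 := L₀.ne_zero l v
  field_simp at h1
  linear_combination h1

include hl hδ N in
theorem nonempty_iso_directSum_dual (hφ : IsPhi L₀ φ) :
    Nonempty ((bundleE' L₀ φ).Iso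
      (PreBundle.directSum fun _ : Fin δ => L₀.dual.toPreBundle)) := by
  obtain ⟨ψ, F, hψ, hF⟩ := N.exists_relFrame hl hδ
  obtain ⟨b, hb, hlift⟩ := N.exists_lift_eq hl hφ
  have ha := N.a_ne_zero hl hδ
  have hh := N.differentiable_h
  -- The factor `h w` converts normal-form multipliers in `w` into those of `L₀`. The exponential
  -- compensates the shift `b` of the lift: `b n̄ + b̄ n` is an integer.
  refine ((F.pullback φ).twist (fun w => N.h w * expTwoPiI (conj b * w)) (by fun_prop)
    fun w => mul_ne_zero (N.h_ne_zero w) (expTwoPiI_ne_zero _)).nonempty_iso_directSum L₀.dual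
    fun i n z w => ?_
  have hper := N.per_eq hlift n
  have h1 : (tildeE' L₀ φ).e (latticePair 0 n) (z, w) =
      expTwoPiI (N.a * conj (n : ℂ) * z) := by
    change L₀.e 0 z * Complex.exp (2 * Real.pi * Complex.I *
      ((φ.lift w + (φ.per n : ℂ)) * conj (0 : ℂ) - conj (φ.per n : ℂ) * z)) = _
    rw [L₀.e_zero, one_mul, hper, expTwoPiI, map_zero, map_mul, N.conj_a]
    congr 2
    ring
  change (L₀.e n w)⁻¹ * (F.θ i z (φ.lift (w + n)) * (N.h (w + n) * expTwoPiI (conj b * (w + n)))) =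
    (tildeE' L₀ φ).e (latticePair 0 n) (z, w) *
      (F.θ i z (φ.lift w) * (N.h w * expTwoPiI (conj b * w)))
  rw [h1, hF, hF, inv_mul_eq_iff_eq_mul₀ (L₀.ne_zero n w)]
  have h2 : z + φ.lift (w + n) / N.a = z + φ.lift w / N.a + n := by
    rw [hlift, hlift]
    field_simp
    ring
  have h3 := (hψ i).2 n (z + φ.lift w / N.a)
  have h4 := N.e_mul n w
  obtain ⟨m, hm⟩ := hb n n.2
  -- The theta multiplier at `z + w + b / a` factors into the Poincaré multiplier in `z` and the
  -- normal-form multiplier in `w`.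
  have h5 : expTwoPiI (N.a * (z + φ.lift w / N.a) * conj (n : ℂ)) *
      expTwoPiI (conj b * (w + n)) = expTwoPiI (N.a * w * conj (n : ℂ)) *
      (expTwoPiI (N.a * conj (n : ℂ) * z) * expTwoPiI (conj b * w)) := by
    rw [← expTwoPiI_add, ← expTwoPiI_add, ← expTwoPiI_add,
      show N.a * (z + φ.lift w / N.a) * conj (n : ℂ) + conj b * (w + n) =
        N.a * w * conj (n : ℂ) + (N.a * conj (n : ℂ) * z + conj b * w) + m by
        rw [← hm, hlift]
        field_simp
        ring, expTwoPiI_add _ (m : ℂ), expTwoPiI_int, mul_one]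
  rw [h2, h3]
  generalize expTwoPiI (N.a * (z + φ.lift w / N.a) * conj (n : ℂ)) = X₁ at *
  generalize expTwoPiI (conj b * (w + n)) = X₂ at *
  generalize expTwoPiI (N.a * w * conj (n : ℂ)) = X₃ at *
  generalize expTwoPiI (N.a * conj (n : ℂ) * z) = X₄ at *
  generalize expTwoPiI (conj b * w) = X₅ at *
  linear_combination N.h z * N.C n * ψ i (z + φ.lift w / N.a) * N.h (w + n) * h5 -
    X₄ * X₅ * N.h z * ψ i (z + φ.lift w / N.a) * h4

end NormalForm

end TorusBundles

end

theorem mainTheorem2 (l₁ l₂ : ℂ) (hl : 0 < (l₂ / l₁).im) (δ : ℕ) (hδ : 0 < δ)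
    (L₀ : TorusBundles.LineBundle (TorusBundles.lattice l₁ l₂))
    (hL₀ : TorusBundles.HasDegree L₀ δ) :
    (∃ φ : TorusBundles.TorusMap (TorusBundles.lattice l₁ l₂)
        (TorusBundles.dualLattice (TorusBundles.lattice l₁ l₂)), TorusBundles.IsPhi L₀ φ) ∧
    ∀ φ : TorusBundles.TorusMap (TorusBundles.lattice l₁ l₂)
        (TorusBundles.dualLattice (TorusBundles.lattice l₁ l₂)), TorusBundles.IsPhi L₀ φ →
      (TorusBundles.bundleE L₀).IsVectorBundle δ ∧
      (TorusBundles.bundleE' L₀ φ).IsVectorBundle δ ∧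
      (∀ μ : ℂ, ((TorusBundles.tildeE' L₀ φ).pullback (TorusBundles.slice _ _ μ)).IsIso
        (TorusBundles.translate L₀ μ)) ∧
      (∃ Φ : ((TorusBundles.bundleE L₀).pullback φ).Iso (TorusBundles.bundleE' L₀ φ),
        TorusBundles.IsCanonical L₀ φ Φ) ∧
      Nonempty ((TorusBundles.bundleE' L₀ φ).Iso
        (TorusBundles.PreBundle.directSum fun _ : Fin δ => L₀.dual.toPreBundle)) := by
  obtain ⟨N⟩ := TorusBundles.nonempty_normalForm hl hL₀
  obtain ⟨-, F, -, -⟩ := N.exists_relFrame hl hδ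
  obtain ⟨ρ, hρ, hdual⟩ := TorusBundles.dualLattice_discrete hl
  obtain ⟨ρ', hρ', hlattice⟩ := N.lattice_discrete hl hδ
  exact ⟨⟨N.phi, N.isPhi_phi hl⟩, fun φ hφ => ⟨F.isVectorBundle_directImage hρ hdual,
    (F.pullback φ).isVectorBundle_directImage hρ' hlattice,
    TorusBundles.NormalForm.tildeE'_isIso_translate hφ,
    F.exists_baseChange_iso hρ hdual φ, N.nonempty_iso_directSum_dual hl hδ hφ⟩⟩
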